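/- **Setting.** For $x\in\mathbb R$ let $\operatorname{sign}(x)\in\{-1,1\}$ (the value at $0$ is irrelevant up to null events). For each $n$ let $\rho=\rho_n$ and let $\nu_t(j),\psi_t(i,j)$ ($t\ge 1$, $1\le i,j\le n$) be independent standard Gaussians. Put $\theta_t(i,j)=\sqrt{\rho}\,\nu_t(j)+\sqrt{1-\rho}\,\psi_t(i,j)$, so that $\theta_1,\theta_2,\dots$ are independent $n\times n$ matrices with independent columns, each column being a centred Gaussian vector with unit variances and all pairwise correlations $\rho$. For $\omega\in\{-1,1\}^n$ let $\omega_0=\omega$, $\omega_t=\operatorname{sign}(\theta_t\omega_{t-1})$ (coordinatewise), and for Boolean $h_n:\{-1,1\}^n\to\{-1,1\}$ let $f_{n,T}(\omega)=h_n(\omega_T)$; this is a random Boolean function, through the weights. Let $\omega$ be uniform on $\{-1,1\}^n$, and let $\omega^{\epsilon}$ be obtained from $\omega$ by flipping each bit independently with probability $\epsilon$, with $(\omega,\omega^\epsilon)$ independent of the weights. Let $C_t\subseteq\{1,\dots,n\}$ be the set of positions where $\omega_t$ and $(\omega^\epsilon)_t$ differ, $D_t=|C_t|$ and $\tilde D_t=D_t/n$.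 For $w=(w_1,w_2)$ and $v\in[0,1]$ let $g_w(v)=\mathrm P\big(\sqrt{1-v}\,|Y|\le\sqrt{v}\,|X|\big)$, where $X\sim N(w_1,1)$ and $Y\sim N(w_2,1)$ are independent. With $d=D_{t-1}$ let $$W_t=\sqrt{\tfrac{\rho}{1-\rho}}\Big(\tfrac1{\sqrt d}\sum_{j\in C_{t-1}}\omega_{t-1}(j)\nu_t(j),\ \tfrac1{\sqrt{n-d}}\sum_{j\notin C_{t-1}}\omega_{t-1}(j)\nu_t(j)\Big)$$ (if $d\in\{0,n\}$ the coordinate with an empty sum is immaterial). Then, given the past and $W_t=w$, $\tilde D_{t-1}=v$, the variable $D_t$ is binomial with parameters $n$ and $g_w(v)$. Let $\tau^{\epsilon}_{1/2}=\min\{t\ge1: g_{W_t}(\tilde D_{t-1})\ge \tfrac12\}$, with $\tau^{\epsilon}_{1/2}=\infty$ if there is no such $t$. **Notions.** The random functions $f_n$ are *annealed QNS at level $\{\epsilon_n\}$* if $\mathrm{Cov}(f_n(\omega),f_n(\omega^{\epsilon_n}))\to0$, the covariance being over $f_n,\omega,\omega^{\epsilon_n}$ jointly. They are *quenched QNS at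 level $\{\epsilon_n\}$* if for every $\delta'>0$, for all large $n$, with probability at least $1-\delta'$ over $f_n$ one has $\mathrm{Cov}_{\omega,\omega^{\epsilon_n}}(f_n(\omega),f_n(\omega^{\epsilon_n}))\le\delta'$. The sequence $\{h_n\}$ *has a sharp threshold at $1/2$* if for every $p_n\in[0,1]$ with $|p_n-\frac12|$ bounded away from $0$, and $\omega$ with i.i.d. bits equal to $1$ with probability $p_n$ and to $-1$ otherwise, $\mathrm P(h_n(\omega)=\operatorname{sign}(p_n-\frac12))\to1$. The function $h_n$ is odd if $h_n(-\omega)=-h_n(\omega)$ for all $\omega$. **Theorem.** There are integers $K_n$, depending only on $n$, such that the following holds. Let $\frac12\ge\epsilon_n$ be non-increasing with $\epsilon_n\to0$ and $n\epsilon_n\to\infty$. Let $\delta>0$ be independent of $n$, and assume that for all sufficiently large $n$ $$\delta<\rho_n<1-\frac{4(\log\log n)^3}{\log n},\qquad T_n\ge e^{4(\log\log n)^2}.$$ Then: (i) $\lim_{n\to\infty}\mathrm P\big(\tau^{\epsilon_n}_{1/2}>T_n\big)=0$. (ii) If $h_n$ is odd for all large $n$ and $\{h_n\}$ has a sharp threshold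 at $1/2$, then $\{f_{n,T_n}\}$ is annealed QNS and quenched QNS at level $\{\epsilon_n\}$. (iii) If $h_n$ is odd for all large $n$ and $T_n\ge K_n$ for all large $n$, then $\{f_{n,T_n}\}$ is annealed QNS and quenched QNS at level $\{\epsilon_n\}$. -/

import Mathlib

open MeasureTheory ProbabilityTheory Filter Topology

noncomputable section

/-- The Boolean cube `{-1, 1}^n`; `ℤˣ` is the two-point set `{1, -1}`. -/
abbrev Cube (n : ℕ) : Type := Fin n → ℤˣ

/-- The set of Boolean functions `{-1, 1}^n → {-1, 1}`. -/
abbrev BoolFun (n : ℕ) : Type := Cube n → ℤˣ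

/-- The real number `1` or `-1` given by a sign. -/
def signVal (u : ℤˣ) : ℝ := ((u : ℤ) : ℝ)

/-- The sign of a real number (the value at `0` only matters on a null event). -/
def realSign (x : ℝ) : ℤˣ := if 0 < x then 1 else -1

instance instMeasurableSingletonClassSigns : MeasurableSingletonClass ℤˣ :=
  ⟨fun u => ⟨{(u : ℤ)}, measurableSet_singleton _, by ext x; simp [Units.ext_iff]⟩⟩

/-! ### Uniform input, noise, and noise sensitivity -/

/-- The law on `{-1, 1}` giving mass `p` to `1` and mass `1 - p` to `-1`, for `0 ≤ p ≤ 1`. -/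
def signBernoulli (p : ℝ) : Measure ℤˣ :=
  ENNReal.ofReal p • Measure.dirac 1 + ENNReal.ofReal (1 - p) • Measure.dirac (-1)

/-- The law of `n` i.i.d. signs that are `1` with probability `p`. -/
def cubeBernoulli (n : ℕ) (p : ℝ) : Measure (Cube n) :=
  Measure.pi fun _ => signBernoulli p

/-- The joint law of `(ω, ω^ε)`: `ω` is uniform on the cube, and each bit of `ω` is flipped
independently with probability `ε` (the factor `x.2` is `-1` exactly at the flipped bits). -/
def noisyPair (n : ℕ) (ε : ℝ) : Measure (Cube n × Cube n) :=
  ((cubeBernoulli n (1 / 2)).prod (cubeBernoulli n (1 - ε))).map fun x => (x.1, x.1 * x.2)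

/-- A sequence `π n` of laws of random Boolean functions is annealed QNS at level `ε`: the
covariance of `f(ω)` and `f(ω^ε)`, over `f`, `ω` and `ω^ε` jointly, tends to `0`. -/
def AnnealedQNS (π : (n : ℕ) → Measure (BoolFun n)) (ε : ℕ → ℝ) : Prop :=
  Tendsto (fun n => covariance (fun x : BoolFun n × (Cube n × Cube n) => signVal (x.1 x.2.1))
    (fun x => signVal (x.1 x.2.2)) ((π n).prod (noisyPair n (ε n)))) atTop (𝓝 0)

/-- A sequence `π n` of laws of random Boolean functions is quenched QNS at level `ε`. -/
def QuenchedQNS (π : (n : ℕ) → Measure (BoolFun n)) (ε : ℕ → ℝ) : Prop :=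
  ∀ δ : ℝ, 0 < δ → ∃ N : ℕ, ∀ n ≥ N,
    1 - δ ≤ (π n).real {f | covariance (fun x : Cube n × Cube n => signVal (f x.1))
      (fun x => signVal (f x.2)) (noisyPair n (ε n)) ≤ δ}

/-- Sharp threshold at `1/2`: if `p n - 1/2` is bounded away from `0` and the bits are i.i.d. and
equal to `1` with probability `p n`, then `h n` equals the sign of `p n - 1/2` with probability
tending to `1`. -/
def SharpThresholdAtHalf (h : (n : ℕ) → BoolFun n) : Prop :=
  ∀ p : ℕ → ℝ, (∀ n, 0 ≤ p n ∧ p n ≤ 1) → (∃ c : ℝ, 0 < c ∧ ∀ n, c ≤ |p n - 1 / 2|) →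
    Tendsto (fun n => (cubeBernoulli n (p n)).real {ω | h n ω = realSign (p n - 1 / 2)})
      atTop (𝓝 1)

/-! ### The network with correlated weights -/

/-- The Gaussian variables behind one layer: the vector `(ν(j))` shared by all rows, and the
matrix `(ψ(i,j))`. -/
abbrev Layer (n : ℕ) : Type := (Fin n → ℝ) × (Fin n → Fin n → ℝ)

/-- All `ν(j)` and `ψ(i,j)` are independent standard Gaussians. -/
def layerLaw (n : ℕ) : Measure (Layer n) :=
  (Measure.pi fun _ => gaussianReal 0 1).prod
    (Measure.pi fun _ => Measure.pi fun _ => gaussianReal 0 1)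

/-- The layers are i.i.d. -/
def networkLaw (n : ℕ) : Measure (ℕ → Layer n) := Measure.infinitePi fun _ => layerLaw n

instance instIsProbabilityMeasureLayerLaw (n : ℕ) : IsProbabilityMeasure (layerLaw n) := by
  unfold layerLaw; infer_instance

instance instIsProbabilityMeasureNetworkLaw (n : ℕ) : IsProbabilityMeasure (networkLaw n) := by
  unfold networkLaw; infer_instance

/-- The weight matrix `θ(i,j) = √ρ ν(j) + √(1-ρ) ψ(i,j)` of a layer. For `0 ≤ ρ ≤ 1` its columns
are independent centred Gaussian vectors with unit variances and all correlations equal to `ρ`. -/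
def weight {n : ℕ} (ρ : ℝ) (L : Layer n) : Matrix (Fin n) (Fin n) ℝ :=
  Matrix.of fun i j => √ρ * L.1 j + √(1 - ρ) * L.2 i j

/-- `ω_t`, where `ω_0 = ω` and `ω_{t+1} = sign(θ_{t+1} ω_t)`. The layer that leads from `ω_t` to
`ω_{t+1}` is `Θ t` (so `Θ 0` is the first layer). -/
def state {n : ℕ} (ρ : ℝ) (Θ : ℕ → Layer n) (ω : Cube n) : ℕ → Cube n
  | 0 => ω
  | t + 1 => fun i =>
      realSign ((weight ρ (Θ t)).mulVec (fun j => signVal (state ρ Θ ω t j)) i)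

/-- The Boolean function `f_{n,T}(ω) = h(ω_T)`. -/
def network {n : ℕ} (ρ : ℝ) (T : ℕ) (h : BoolFun n) (Θ : ℕ → Layer n) : BoolFun n :=
  fun ω => h (state ρ Θ ω T)

theorem measurable_realSign : Measurable realSign :=
  Measurable.ite measurableSet_Ioi measurable_const measurable_const

theorem measurable_state {n : ℕ} (ρ : ℝ) (ω : Cube n) (t : ℕ) :
    Measurable fun Θ : ℕ → Layer n => state ρ Θ ω t := by
  induction t with
  | zero => exact measurable_const
  | succ t ih =>
    refine measurable_pi_lambda _ fun i => measurable_realSign.comp ?_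
    simp only [Matrix.mulVec, dotProduct, weight, Matrix.of_apply]
    refine Finset.measurable_sum _ fun j _ => ?_
    refine Measurable.mul (by fun_prop) ?_
    exact (measurable_of_countable signVal).comp ((measurable_pi_apply j).comp ih)

/-- The random Boolean function is measurable in the weights, so its law below is a genuine
push-forward. -/
theorem measurable_network {n : ℕ} (ρ : ℝ) (T : ℕ) (h : BoolFun n) :
    Measurable (network ρ T h) :=
  measurable_pi_lambda _ fun ω => (measurable_of_countable h).comp (measurable_state ρ ω T)

/-- The law of the random Boolean function `f_{n,T}`. -/
def networkFunLaw (n : ℕ) (ρ : ℝ) (T : ℕ) (h : BoolFun n) : Measure (BoolFun n) :=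
  (networkLaw n).map (network ρ T h)

/-! ### The disagreement process -/

/-- The set of positions at which two inputs differ. -/
def disagree {n : ℕ} (x y : Cube n) : Finset (Fin n) := Finset.univ.filter fun j => x j ≠ y j

/-- The proportion of positions at which two inputs differ. -/
def disagreeFrac {n : ℕ} (x y : Cube n) : ℝ := ((disagree x y).card : ℝ) / n

/-- `g_w(v) = P(|Y| ≤ √(v/(1-v)) |X|)` for independent `X ~ N(w₁, 1)`, `Y ~ N(w₂, 1)`. The
inequality is multiplied by `√(1-v)`, so that `g_w(1) = 1`. -/
def gProb (w : ℝ × ℝ) (v : ℝ) : ℝ :=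
  ((gaussianReal w.1 1).prod (gaussianReal w.2 1)).real {p | √(1 - v) * |p.2| ≤ √v * |p.1|}

/-- `W = √(ρ/(1-ρ)) (U^C, U^{Cᶜ})`, where `C` is the set of the `d` positions at which `x` and `y`
differ, `√d U^C = ∑_{j ∈ C} x(j) ν(j)` and `√(n-d) U^{Cᶜ} = ∑_{j ∉ C} x(j) ν(j)`. If `d = 0` or
`d = n`, one of the two coordinates is immaterial, as `g_w(0) = 0` and `g_w(1) = 1` for all `w`. -/
def wVec {n : ℕ} (ρ : ℝ) (ν : Fin n → ℝ) (x y : Cube n) : ℝ × ℝ :=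
  (√(ρ / (1 - ρ)) * ((∑ j ∈ disagree x y, signVal (x j) * ν j) / √((disagree x y).card : ℝ)),
   √(ρ / (1 - ρ)) *
    ((∑ j ∈ (disagree x y)ᶜ, signVal (x j) * ν j) / √((n : ℝ) - (disagree x y).card)))

/-- `τ_c = min {t ≥ 1 : g_{W_t}(D_{t-1} / n) ≥ c}` (and `∞` if there is no such `t`) for the
network started from the two inputs `x` and `y`. Here `t = s + 1`, and the shared Gaussian vector
of layer `t` is `(Θ s).1`. -/
def hitTime {n : ℕ} (ρ c : ℝ) (Θ : ℕ → Layer n) (x y : Cube n) : ℕ∞ :=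
  ⨅ (s : ℕ) (_ : c ≤ gProb (wVec ρ (Θ s).1 (state ρ Θ x s) (state ρ Θ y s))
    (disagreeFrac (state ρ Θ x s) (state ρ Θ y s))), ((s + 1 : ℕ) : ℕ∞)

/-!
The noise operator on the cube is positive for `ε ≤ 1/2`, so the noise stability
`E[f(ω) f(ω^ε)]` of every Boolean `f` is nonnegative; for odd `f` it is the covariance. By Markov's
inequality both notions of QNS follow once the mean of the noise stability over the weights tends
to `0`.

Given the shared vector of a layer, the outputs of this layer at two inputs differ independently at
each position, with probability `g`. As the law of the next layer is invariant under sign changes of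
its columns, the expected product of two outputs of the remaining network depends only on the set of
disagreements; it is therefore the mean noise stability at level `g` of the remaining network, which
is nonpositive when `g ≥ 1/2` and the readout is odd. Hence the mean noise stability is at most the
probability that `g < 1/2` at each of the first `T - 1` layers, the survival probability of the
chain of pairs of states killed when `g ≥ 1/2`.

When `|W₁|` exceeds a constant and `|W₂| ≤ 1`, either `g ≥ 1/2` or the layer raises the proportion
`v` of disagreements above `√v` with probability at least `1/2`. Starting from `v ≥ 1/n`, about
`log log n` such layers in a row lead to `g ≥ 1/2`; this happens with probability at least
`exp (-2 (log log n)²)`. Distinct states are unlikely to merge in one layer, because `|W₂|` is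
rarely large. So among `exp (4 (log log n)²)` layers some block of successive layers succeeds before
the states merge. Finally, `ω = ω^ε` has probability `(1 - ε)^n ≤ exp (-n ε)`.
-/

noncomputable section

/-! ### Noise on the cube -/

section Noise

variable {n : ℕ} {p ε : ℝ}

@[simp] theorem signVal_one : signVal 1 = 1 := by simp [signVal]

@[simp] theorem signVal_neg (u : ℤˣ) : signVal (-u) = -signVal u := by simp [signVal]

theorem signVal_mul (u v : ℤˣ) : signVal (u * v) = signVal u * signVal v := by simp [signVal]

theorem signVal_mul_self (u : ℤˣ) : signVal u * signVal u = 1 := by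
  rw [← signVal_mul, Int.units_mul_self, signVal_one]

theorem abs_signVal (u : ℤˣ) : |signVal u| = 1 := by
  rcases Int.units_eq_one_or u with rfl | rfl <;> simp

theorem Cube.mul_self (x : Cube n) : x * x = 1 := funext fun i => Int.units_mul_self (x i)

theorem isProbabilityMeasure_signBernoulli (hp : p ∈ unitInterval) :
    IsProbabilityMeasure (signBernoulli p) where
  measure_univ := by
    simp only [signBernoulli, Measure.add_apply, Measure.smul_apply, measure_univ, smul_eq_mul,
      mul_one]
    rw [← ENNReal.ofReal_add hp.1 (sub_nonneg.2 hp.2), add_sub_cancel, ENNReal.ofReal_one]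

theorem isProbabilityMeasure_cubeBernoulli (n : ℕ) (hp : p ∈ unitInterval) :
    IsProbabilityMeasure (cubeBernoulli n p) := by
  have := isProbabilityMeasure_signBernoulli hp
  unfold cubeBernoulli
  infer_instance

instance isProbabilityMeasure_cubeBernoulli_half (n : ℕ) :
    IsProbabilityMeasure (cubeBernoulli n (1 / 2)) :=
  isProbabilityMeasure_cubeBernoulli n ⟨by norm_num, by norm_num⟩

theorem isProbabilityMeasure_noisyPair (n : ℕ) (hε : ε ∈ unitInterval) :
    IsProbabilityMeasure (noisyPair n ε) := by
  have := isProbabilityMeasure_cubeBernoulli n (Set.Icc.one_sub_mem hε)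
  exact Measure.isProbabilityMeasure_map (measurable_of_countable _).aemeasurable

theorem signBernoulli_real_singleton (hp : p ∈ unitInterval) (u : ℤˣ) :
    (signBernoulli p).real {u} = (1 + (2 * p - 1) * signVal u) / 2 := by
  have h : (1 : ℤˣ) ≠ -1 := by decide
  rcases Int.units_eq_one_or u with rfl | rfl
  · simp [signBernoulli, Measure.real, hp.1]
  · simp [signBernoulli, Measure.real, hp.2, h]
    ring

theorem cubeBernoulli_real_singleton (hp : p ∈ unitInterval) (x : Cube n) :
    (cubeBernoulli n p).real {x} = (1 / 2) ^ n * ∏ i, (1 + (2 * p - 1) * signVal (x i)) := by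
  have := isProbabilityMeasure_signBernoulli hp
  rw [cubeBernoulli, Measure.real, Measure.pi_singleton, ENNReal.toReal_prod]
  calc ∏ i, (signBernoulli p).real {x i}
      = ∏ i, 1 / 2 * (1 + (2 * p - 1) * signVal (x i)) :=
        Finset.prod_congr rfl fun i _ => by rw [signBernoulli_real_singleton hp]; ring
    _ = (1 / 2) ^ n * ∏ i, (1 + (2 * p - 1) * signVal (x i)) := by
        rw [Finset.prod_mul_distrib, Finset.prod_const, Finset.card_univ, Fintype.card_fin]

theorem cubeBernoulli_half_real_singleton (x : Cube n) :
    (cubeBernoulli n (1 / 2)).real {x} = (1 / 2) ^ n := by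
  rw [cubeBernoulli_real_singleton ⟨by norm_num, by norm_num⟩]
  norm_num

theorem integral_cubeBernoulli_half (F : Cube n → ℝ) :
    ∫ x, F x ∂cubeBernoulli n (1 / 2) = (1 / 2) ^ n * ∑ x, F x := by
  simp only [integral_fintype Integrable.of_finite, cubeBernoulli_half_real_singleton,
    smul_eq_mul, Finset.mul_sum]

theorem integral_neg_cubeBernoulli_half (F : Cube n → ℝ) :
    ∫ x, F (-x) ∂cubeBernoulli n (1 / 2) = ∫ x, F x ∂cubeBernoulli n (1 / 2) := by
  simp only [integral_cubeBernoulli_half]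
  congr 1
  exact Fintype.sum_equiv (Equiv.neg _) _ _ fun _ => rfl

/-- The Walsh characters `x ↦ ∏ i ∈ s, x i`, an orthonormal basis of the real functions on the
uniform cube. -/
def walsh (s : Finset (Fin n)) (x : Cube n) : ℝ := ∏ i ∈ s, signVal (x i)

theorem walsh_neg (s : Finset (Fin n)) (x : Cube n) : walsh s (-x) = (-1) ^ s.card * walsh s x := by
  simp only [walsh, Pi.neg_apply, signVal_neg, Finset.prod_neg]

theorem walsh_mul (s : Finset (Fin n)) (x y : Cube n) :
    walsh s (x * y) = walsh s x * walsh s y := by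
  simp only [walsh, Pi.mul_apply, signVal_mul, Finset.prod_mul_distrib]

/-- The Fourier–Walsh coefficient of `F` at `s`. -/
def walshCoeff (F : Cube n → ℝ) (s : Finset (Fin n)) : ℝ :=
  ∫ x, F x * walsh s x ∂cubeBernoulli n (1 / 2)

theorem walshCoeff_eq_zero_of_odd {F : Cube n → ℝ} (hF : F.Odd) {s : Finset (Fin n)}
    (hs : Even s.card) : walshCoeff F s = 0 := by
  have h := integral_neg_cubeBernoulli_half fun x => F x * walsh s x
  simp only [hF _, walsh_neg, hs.neg_one_pow, one_mul, neg_mul, integral_neg] at h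
  exact self_eq_neg.1 h.symm

theorem noisyPair_real_singleton (hε : ε ∈ unitInterval) (x y : Cube n) :
    (noisyPair n ε).real {(x, y)} =
      (1 / 4) ^ n * ∑ s, (1 - 2 * ε) ^ s.card * (walsh s x * walsh s y) := by
  have hε' := Set.Icc.one_sub_mem hε
  have := isProbabilityMeasure_cubeBernoulli n hε'
  have hpre : (fun z : Cube n × Cube n => (z.1, z.1 * z.2)) ⁻¹' {(x, y)} = {x} ×ˢ {x * y} := by
    ext z
    simp only [Set.mem_preimage, Set.mem_singleton_iff, Prod.mk.injEq, Set.mem_prod]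
    refine and_congr_right fun hz => ?_
    rw [hz, ← mul_right_inj x, ← mul_assoc, Cube.mul_self, one_mul]
  have hexpand : ∏ i, (1 + (1 - 2 * ε) * signVal ((x * y) i)) =
      ∑ s, (1 - 2 * ε) ^ s.card * (walsh s x * walsh s y) := by
    simp only [Finset.prod_one_add, Finset.powerset_univ, Finset.prod_mul_distrib,
      Finset.prod_const, ← walsh_mul]
    rfl
  rw [noisyPair, map_measureReal_apply (measurable_of_countable _) (measurableSet_singleton _),
    hpre, measureReal_prod_prod, cubeBernoulli_half_real_singleton,
    cubeBernoulli_real_singleton hε', ← hexpand, ← mul_assoc, ← mul_pow]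
  ring_nf

/-- The noise stability `E[F(ω) F(ω^ε)]`. -/
def noiseStab (ε : ℝ) (F : Cube n → ℝ) : ℝ := ∫ p, F p.1 * F p.2 ∂noisyPair n ε

theorem noiseStab_eq_sum_walshCoeff (hε : ε ∈ unitInterval) (F : Cube n → ℝ) :
    noiseStab ε F = ∑ s, (1 - 2 * ε) ^ s.card * walshCoeff F s ^ 2 := by
  have := isProbabilityMeasure_noisyPair n hε
  have hsq (s : Finset (Fin n)) : walshCoeff F s ^ 2 =
      ∑ p : Cube n × Cube n, (1 / 4) ^ n * (walsh s p.1 * walsh s p.2) * (F p.1 * F p.2) := by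
    rw [walshCoeff, integral_cubeBernoulli_half, mul_pow, ← pow_mul, mul_comm n 2, pow_mul,
      sq (∑ x, _), Finset.sum_mul_sum, ← Fintype.sum_prod_type', Finset.mul_sum]
    exact Finset.sum_congr rfl fun p _ => by norm_num; ring
  simp only [noiseStab, integral_fintype Integrable.of_finite, noisyPair_real_singleton hε, hsq,
    smul_eq_mul, Finset.mul_sum, Finset.sum_mul]
  rw [Finset.sum_comm]
  exact Finset.sum_congr rfl fun s _ => Finset.sum_congr rfl fun p _ => by ring

theorem noiseStab_nonneg (h0 : 0 ≤ ε) (h1 : ε ≤ 1 / 2) (F : Cube n → ℝ) : 0 ≤ noiseStab ε F := by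
  rw [noiseStab_eq_sum_walshCoeff ⟨h0, by linarith⟩]
  exact Finset.sum_nonneg fun s _ => mul_nonneg (pow_nonneg (by linarith) _) (sq_nonneg _)

theorem noiseStab_nonpos_of_odd (h0 : 1 / 2 ≤ ε) (h1 : ε ≤ 1) {F : Cube n → ℝ} (hF : F.Odd) :
    noiseStab ε F ≤ 0 := by
  rw [noiseStab_eq_sum_walshCoeff ⟨by linarith, h1⟩]
  refine Finset.sum_nonpos fun s _ => ?_
  rcases s.card.even_or_odd with hs | hs
  · simp [walshCoeff_eq_zero_of_odd hF hs]
  · exact mul_nonpos_of_nonpos_of_nonneg (hs.pow_nonpos (by linarith)) (sq_nonneg _)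

theorem map_fst_noisyPair (hε : ε ∈ unitInterval) :
    (noisyPair n ε).map Prod.fst = cubeBernoulli n (1 / 2) := by
  have := isProbabilityMeasure_cubeBernoulli n (Set.Icc.one_sub_mem hε)
  rw [noisyPair, Measure.map_map measurable_fst (measurable_of_countable _)]
  exact measurePreserving_fst.map_eq

theorem integral_fst_noisyPair_of_odd (hε : ε ∈ unitInterval) {F : Cube n → ℝ} (hF : F.Odd) :
    ∫ p, F p.1 ∂noisyPair n ε = 0 := by
  have h := walshCoeff_eq_zero_of_odd hF (s := ∅) (by simp)
  simp only [walshCoeff, walsh, Finset.prod_empty, mul_one] at h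
  rw [← map_fst_noisyPair hε, integral_map measurable_fst.aemeasurable
    (measurable_of_countable F).aestronglyMeasurable] at h
  exact h

theorem noiseStab_eq_covariance_of_odd (hε : ε ∈ unitInterval) {F : Cube n → ℝ} (hF : F.Odd) :
    cov[fun p => F p.1, fun p => F p.2; noisyPair n ε] = noiseStab ε F := by
  have := isProbabilityMeasure_noisyPair n hε
  rw [covariance_eq_sub .of_discrete .of_discrete, integral_fst_noisyPair_of_odd hε hF, zero_mul,
    sub_zero]
  rfl

theorem noisyPair_real_diagonal (hε : ε ∈ unitInterval) :
    (noisyPair n ε).real {p | p.1 = p.2} = (1 - ε) ^ n := by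
  have hε' := Set.Icc.one_sub_mem hε
  have := isProbabilityMeasure_cubeBernoulli n hε'
  have hpre : (fun x : Cube n × Cube n => (x.1, x.1 * x.2)) ⁻¹' {p | p.1 = p.2} =
      Set.univ ×ˢ {1} := by
    ext x
    simp
  rw [noisyPair, map_measureReal_apply (measurable_of_countable _) (Set.toFinite _).measurableSet,
    hpre, measureReal_prod_prod, probReal_univ, one_mul, cubeBernoulli_real_singleton hε']
  simp only [Pi.one_apply, signVal_one, mul_one, Finset.prod_const, Finset.card_univ,
    Fintype.card_fin, ← mul_pow]
  ring

end Noise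

/-! ### Products of probability measures -/

theorem measurePreserving_infinitePi_head_tail {X : ℕ → Type*} [∀ t, MeasurableSpace (X t)]
    (μ : ∀ t, Measure (X t)) [∀ t, IsProbabilityMeasure (μ t)] :
    MeasurePreserving (fun Θ : ∀ t, X t => (Θ 0, fun t => Θ (t + 1))) (Measure.infinitePi μ)
      ((μ 0).prod (Measure.infinitePi fun t => μ (t + 1))) := by
  have hcoord : iIndepFun (fun t (Θ : ∀ t, X t) => Θ t) (Measure.infinitePi μ) :=
    iIndepFun_infinitePi fun _ => measurable_id
  have htail : (Measure.infinitePi μ).map (fun Θ t => Θ (t + 1)) =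
      Measure.infinitePi fun t => μ (t + 1) := by
    rw [(hcoord.precomp Nat.succ_injective).map_fun_eq_infinitePi_map fun t =>
      measurable_pi_apply (t + 1)]
    simp only [Measure.infinitePi_map_eval]
  have hindep : IndepFun (fun Θ : ∀ t, X t => Θ 0) (fun Θ t => Θ (t + 1))
      (Measure.infinitePi μ) := by
    refine IndepFun.indepFun_process (by fun_prop) (fun t => by fun_prop) fun I => ?_
    have hdisj : Disjoint {0} (I.map (addRightEmbedding 1)) := by simp
    refine (hcoord.indepFun_finset {0} (I.map (addRightEmbedding 1)) hdisj
      measurable_pi_apply).comp (φ := fun v => v ⟨0, Finset.mem_singleton_self 0⟩)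
      (ψ := fun v (t : I) => v ⟨t + 1, Finset.mem_map_of_mem _ t.2⟩) ?_ ?_
    · exact measurable_pi_apply _
    · exact measurable_pi_lambda _ fun t => measurable_pi_apply _
  refine ⟨by fun_prop, ?_⟩
  rw [hindep.map_prod_eq_prod_map_map (measurable_pi_apply 0).aemeasurable
    (measurable_pi_lambda _ fun t => measurable_pi_apply (t + 1)).aemeasurable, htail,
    Measure.infinitePi_map_eval]

/-! ### Gaussian sums -/

section GaussianSums

variable {n : ℕ}

/-- The law of `n` independent standard Gaussians: the shared vector of a layer, and each row of
its private matrix. -/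
abbrev stdGaussianPi (n : ℕ) : Measure (Fin n → ℝ) := Measure.pi fun _ => gaussianReal 0 1

theorem map_sum_mul_pi_gaussianReal {ι : Type*} [Fintype ι] (a : ι → ℝ) (s : Finset ι) :
    (Measure.pi fun _ : ι => gaussianReal 0 1).map (fun ν => ∑ j ∈ s, a j * ν j) =
      gaussianReal 0 (∑ j ∈ s, ‖a j‖₊ ^ 2) := by
  have hindep : iIndepFun (fun j (ν : ι → ℝ) => a j * ν j)
      (Measure.pi fun _ : ι => gaussianReal 0 1) :=
    iIndepFun_pi (X := fun j r => a j * r) fun j => by fun_prop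
  have hterm (j : ι) : (Measure.pi fun _ : ι => gaussianReal 0 1).map (fun ν => a j * ν j) =
      gaussianReal 0 (‖a j‖₊ ^ 2) := by
    rw [(gaussianReal_const_mul (measurePreserving_eval (fun _ : ι => gaussianReal 0 1) j).hasLaw
      (a j)).map_eq, mul_zero, mul_one]
    congr 1
    ext
    simp
  refine Measure.ext_of_charFun ?_
  rw [(hindep.restrict s).charFun_map_fun_finsetSum_eq_prod
    fun j _ => (by fun_prop : Measurable fun ν : ι → ℝ => a j * ν j).aemeasurable]
  ext t
  simp only [hterm, Finset.prod_apply, charFun_gaussianReal, ← Complex.exp_sum]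
  simp [Finset.sum_mul, Finset.sum_div]

/-- The signed sum `∑ j ∈ s, x(j) ν(j)`; `U^C` and `U^{Cᶜ}` are multiples of such sums. -/
def signedSum (s : Finset (Fin n)) (x : Cube n) (ν : Fin n → ℝ) : ℝ :=
  ∑ j ∈ s, signVal (x j) * ν j

@[fun_prop]
theorem measurable_signedSum (s : Finset (Fin n)) (x : Cube n) : Measurable (signedSum s x) := by
  unfold signedSum; fun_prop

theorem signedSum_neg (s : Finset (Fin n)) (x : Cube n) (ν : Fin n → ℝ) :
    signedSum s (-x) ν = -signedSum s x ν := by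
  simp [signedSum]

theorem signedSum_add_compl (s : Finset (Fin n)) (x : Cube n) (ν : Fin n → ℝ) :
    signedSum s x ν + signedSum sᶜ x ν = signedSum Finset.univ x ν :=
  Finset.sum_add_sum_compl _ _

theorem map_signedSum (s : Finset (Fin n)) (x : Cube n) :
    (stdGaussianPi n).map (signedSum s x) = gaussianReal 0 s.card := by
  have hnorm (u : ℤˣ) : ‖signVal u‖₊ ^ 2 = 1 := by
    ext
    simp [abs_signVal]
  have h := map_sum_mul_pi_gaussianReal (fun j => signVal (x j)) s
  simp only [hnorm, Finset.sum_const, nsmul_eq_mul, mul_one] at h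
  exact h

theorem indepFun_signedSum_compl (s : Finset (Fin n)) (x : Cube n) :
    IndepFun (signedSum s x) (signedSum sᶜ x) (stdGaussianPi n) := by
  have hterms : iIndepFun (fun j (ν : Fin n → ℝ) => signVal (x j) * ν j) (stdGaussianPi n) :=
    iIndepFun_pi (X := fun j r => signVal (x j) * r) fun j => by fun_prop
  have hsum (s : Finset (Fin n)) : signedSum s x =
      (fun v : s → ℝ => ∑ j, v j) ∘ fun ν j => signVal (x j) * ν j := by
    ext ν
    exact (Finset.sum_coe_sort s fun j => signVal (x j) * ν j).symm
  rw [hsum s, hsum sᶜ]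
  exact (hterms.indepFun_finset s sᶜ disjoint_compl_right fun _ => by fun_prop).comp
    (by fun_prop) (by fun_prop)

end GaussianSums

/-! ### One layer -/

section OneLayer

variable {n : ℕ} {ρ : ℝ}

/-- The contribution of the inputs in `s` to the preactivation of a row with shared vector `ν` and
private vector `r`. -/
def preact (ρ : ℝ) (s : Finset (Fin n)) (ν r : Fin n → ℝ) (x : Cube n) : ℝ :=
  √ρ * signedSum s x ν + √(1 - ρ) * signedSum s x r

/-- One step of the network: the output of the layer `L` at the input `x`. -/
def step (ρ : ℝ) (L : Layer n) (x : Cube n) : Cube n :=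
  fun i => realSign (preact ρ Finset.univ L.1 (L.2 i) x)

theorem state_succ (ρ : ℝ) (Θ : ℕ → Layer n) (x : Cube n) (t : ℕ) :
    state ρ Θ x (t + 1) = step ρ (Θ t) (state ρ Θ x t) := by
  ext1 i
  simp only [state, step, preact, signedSum, Matrix.mulVec, dotProduct, weight, Matrix.of_apply,
    Finset.mul_sum, ← Finset.sum_add_distrib]
  congr 1
  exact Finset.sum_congr rfl fun j _ => by ring

theorem state_succ_eq_state_step (ρ : ℝ) (Θ : ℕ → Layer n) (x : Cube n) (t : ℕ) :
    state ρ Θ x (t + 1) = state ρ (fun s => Θ (s + 1)) (step ρ (Θ 0) x) t := by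
  induction t with
  | zero => rw [state_succ]; rfl
  | succ t ih => rw [state_succ, ih, state_succ]

@[fun_prop]
theorem measurable_preact (ρ : ℝ) (s : Finset (Fin n)) (ν : Fin n → ℝ) (x : Cube n) :
    Measurable fun r => preact ρ s ν r x := by
  unfold preact; fun_prop

theorem measurable_step (ρ : ℝ) (x : Cube n) : Measurable fun L : Layer n => step ρ L x := by
  refine measurable_pi_lambda _ fun i => measurable_realSign.comp ?_
  unfold preact signedSum
  fun_prop

theorem preact_neg (ρ : ℝ) (s : Finset (Fin n)) (ν r : Fin n → ℝ) (x : Cube n) :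
    preact ρ s ν r (-x) = -preact ρ s ν r x := by
  simp only [preact, signedSum_neg]
  ring

theorem preact_add_compl (ρ : ℝ) (s : Finset (Fin n)) (ν r : Fin n → ℝ) (x : Cube n) :
    preact ρ s ν r x + preact ρ sᶜ ν r x = preact ρ Finset.univ ν r x := by
  simp only [preact, ← signedSum_add_compl s]
  ring

theorem map_preact (hρ : ρ ≤ 1) (s : Finset (Fin n)) (ν : Fin n → ℝ) (x : Cube n) :
    (stdGaussianPi n).map (fun r => preact ρ s ν r x) =
      gaussianReal (√ρ * signedSum s x ν) ((1 - ρ).toNNReal * s.card) := by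
  have h : HasLaw (signedSum s x) (gaussianReal 0 s.card) (stdGaussianPi n) :=
    ⟨by fun_prop, map_signedSum s x⟩
  have hlaw := gaussianReal_const_add (gaussianReal_const_mul h (√(1 - ρ)))
    (√ρ * signedSum s x ν)
  refine hlaw.map_eq.trans ?_
  congr 1
  · simp
  · ext
    simp [hρ]

theorem ae_preact_univ_ne_zero (hn : n ≠ 0) (hρ : ρ < 1) (ν : Fin n → ℝ) (x : Cube n) :
    ∀ᵐ r ∂stdGaussianPi n, preact ρ Finset.univ ν r x ≠ 0 := by
  have hvar : (1 - ρ).toNNReal * ((Finset.univ : Finset (Fin n)).card : NNReal) ≠ 0 := by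
    simp [hn, hρ]
  have := nullSingletonClass_gaussianReal (μ := √ρ * signedSum Finset.univ x ν) hvar
  refine ae_of_ae_map (f := fun r => preact ρ Finset.univ ν r x) (by fun_prop)
    (p := fun t => t ≠ 0) ?_
  rw [map_preact hρ.le]
  exact Measure.ae_ne _ _

theorem realSign_neg {a : ℝ} (ha : a ≠ 0) : realSign (-a) = -realSign a := by
  rcases ha.lt_or_gt with h | h <;> simp [realSign, h, h.not_gt]

theorem step_neg_of_preact_ne_zero {L : Layer n} {x : Cube n}
    (h : ∀ i, preact ρ Finset.univ L.1 (L.2 i) x ≠ 0) : step ρ L (-x) = -step ρ L x := by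
  ext1 i
  rw [Pi.neg_apply, step, step, preact_neg, realSign_neg (h i)]

theorem realSign_mul_realSign_eq_neg_one_iff {a b : ℝ} (ha : a ≠ 0) (hb : b ≠ 0) :
    realSign a * realSign b = -1 ↔ a * b < 0 := by
  have h : (1 : ℤˣ) ≠ -1 := by decide
  rcases ha.lt_or_gt with ha | ha <;> rcases hb.lt_or_gt with hb | hb
  · simpa [realSign, ha.not_gt, hb.not_gt, h] using (mul_pos_of_neg_of_neg ha hb).le
  · simpa [realSign, ha.not_gt, hb] using mul_neg_of_neg_of_pos ha hb
  · simpa [realSign, ha, hb.not_gt] using mul_neg_of_pos_of_neg ha hb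
  · simpa [realSign, ha, hb, h] using (mul_pos ha hb).le

theorem signedSum_univ_eq_sub_disagree (x y : Cube n) (ν : Fin n → ℝ) :
    signedSum Finset.univ y ν =
      signedSum (disagree x y)ᶜ x ν - signedSum (disagree x y) x ν := by
  rw [← signedSum_add_compl (disagree x y) y ν, sub_eq_neg_add, ← signedSum_neg]
  congr 1
  · refine Finset.sum_congr rfl fun j hj => ?_
    have hne : y j ≠ x j := (Finset.mem_filter.1 hj).2.symm
    rw [Pi.neg_apply, Int.units_ne_iff_eq_neg.1 hne]
  · refine Finset.sum_congr rfl fun j hj => ?_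
    have heq : x j = y j := by simpa [disagree] using hj
    rw [heq]

theorem realSign_preact_mul_eq_neg_one_iff {ν r : Fin n → ℝ} {x y : Cube n}
    (hx : preact ρ Finset.univ ν r x ≠ 0) (hy : preact ρ Finset.univ ν r y ≠ 0) :
    realSign (preact ρ Finset.univ ν r x) * realSign (preact ρ Finset.univ ν r y) = -1 ↔
      |preact ρ (disagree x y)ᶜ ν r x| ≤ |preact ρ (disagree x y) ν r x| := by
  set a := preact ρ (disagree x y)ᶜ ν r x with ha
  set b := preact ρ (disagree x y) ν r x with hb
  have hx' : preact ρ Finset.univ ν r x = a + b := by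
    rw [← preact_add_compl ρ (disagree x y), add_comm]
  have hy' : preact ρ Finset.univ ν r y = a - b := by
    simp only [ha, hb, preact, signedSum_univ_eq_sub_disagree x y]
    ring
  rw [realSign_mul_realSign_eq_neg_one_iff hx hy, ← sq_le_sq]
  have hne : a ^ 2 ≠ b ^ 2 := by
    rw [← sub_ne_zero, sq_sub_sq, ← hx', ← hy']
    exact mul_ne_zero hx hy
  rw [hx', hy', ← sq_sub_sq, sub_neg, hne.le_iff_lt]

theorem card_compl_disagree (x y : Cube n) :
    ((disagree x y)ᶜ.card : ℝ) = n - (disagree x y).card := by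
  rw [Finset.card_compl, Nat.cast_sub (Finset.card_le_univ _), Fintype.card_fin]

/-- The coordinates of `wVec` as a function of the set of summation: `√(ρ/(1-ρ)) U^s`. -/
def normalizedSum (ρ : ℝ) (s : Finset (Fin n)) (x : Cube n) (ν : Fin n → ℝ) : ℝ :=
  √(ρ / (1 - ρ)) * (signedSum s x ν / √(s.card : ℝ))

theorem wVec_eq (ρ : ℝ) (ν : Fin n → ℝ) (x y : Cube n) :
    wVec ρ ν x y =
      (normalizedSum ρ (disagree x y) x ν, normalizedSum ρ (disagree x y)ᶜ x ν) := by
  simp only [wVec, normalizedSum, signedSum, card_compl_disagree]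

theorem map_preact_eq_map_gaussianReal_normalizedSum (hρ0 : 0 ≤ ρ) (hρ : ρ < 1)
    (s : Finset (Fin n)) (ν : Fin n → ℝ) (x : Cube n) :
    (stdGaussianPi n).map (fun r => preact ρ s ν r x) =
      (gaussianReal (normalizedSum ρ s x ν) 1).map fun t => √(1 - ρ) * √(s.card : ℝ) * t := by
  rw [map_preact hρ.le, gaussianReal_map_const_mul]
  congr 1
  · rcases s.eq_empty_or_nonempty with rfl | hs
    · simp [signedSum]
    · have hρ' : √(1 - ρ) ≠ 0 := (Real.sqrt_pos.2 (sub_pos.2 hρ)).ne'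
      have hcard : √(s.card : ℝ) ≠ 0 := (Real.sqrt_pos.2 (by exact_mod_cast hs.card_pos)).ne'
      rw [normalizedSum, Real.sqrt_div hρ0]
      field_simp
  · ext
    simp [mul_pow, hρ.le]

theorem gProb_wVec_disagreeFrac (hn : n ≠ 0) (ρ : ℝ) (ν : Fin n → ℝ) (x y : Cube n) :
    gProb (wVec ρ ν x y) (disagreeFrac x y) =
      ((gaussianReal (normalizedSum ρ (disagree x y) x ν) 1).prod
        (gaussianReal (normalizedSum ρ (disagree x y)ᶜ x ν) 1)).real
        {p | √((disagree x y)ᶜ.card : ℝ) * |p.2| ≤ √((disagree x y).card : ℝ) * |p.1|} := by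
  have hn' : (0 : ℝ) < n := by positivity
  have hfrac : 1 - disagreeFrac x y = ((disagree x y)ᶜ.card : ℝ) / n := by
    rw [disagreeFrac, card_compl_disagree]
    field_simp
  rw [gProb, wVec_eq, hfrac, disagreeFrac]
  congr 1
  ext p
  simp only [Set.mem_ofPred_eq, Real.sqrt_div (Nat.cast_nonneg _), div_mul_eq_mul_div,
    div_le_div_iff_of_pos_right (Real.sqrt_pos.2 hn')]

theorem measureReal_realSign_preact_mul_eq_neg_one (hn : n ≠ 0) (hρ0 : 0 ≤ ρ) (hρ : ρ < 1)
    (ν : Fin n → ℝ) (x y : Cube n) :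
    (stdGaussianPi n).real {r | realSign (preact ρ Finset.univ ν r x) *
      realSign (preact ρ Finset.univ ν r y) = -1} = gProb (wVec ρ ν x y) (disagreeFrac x y) := by
  set C := disagree x y with hC
  have hevent : {r | realSign (preact ρ Finset.univ ν r x) *
      realSign (preact ρ Finset.univ ν r y) = -1} =ᵐ[stdGaussianPi n]
      (fun r => (preact ρ C ν r x, preact ρ Cᶜ ν r x)) ⁻¹' {q | |q.2| ≤ |q.1|} := by
    filter_upwards [ae_preact_univ_ne_zero hn hρ ν x, ae_preact_univ_ne_zero hn hρ ν y]
      with r hx hy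
    exact propext (realSign_preact_mul_eq_neg_one_iff hx hy)
  have hindep : IndepFun (fun r => preact ρ C ν r x) (fun r => preact ρ Cᶜ ν r x)
      (stdGaussianPi n) :=
    (indepFun_signedSum_compl C x).comp (φ := fun t => √ρ * signedSum C x ν + √(1 - ρ) * t)
      (ψ := fun t => √ρ * signedSum Cᶜ x ν + √(1 - ρ) * t) (by fun_prop) (by fun_prop)
  have hmeas : MeasurableSet {q : ℝ × ℝ | |q.2| ≤ |q.1|} :=
    measurableSet_le (by fun_prop) (by fun_prop)
  have hs : 0 < √(1 - ρ) := Real.sqrt_pos.2 (sub_pos.2 hρ)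
  rw [measureReal_congr hevent, ← map_measureReal_apply (by fun_prop) hmeas,
    hindep.map_prod_eq_prod_map_map (by fun_prop) (by fun_prop),
    map_preact_eq_map_gaussianReal_normalizedSum hρ0 hρ,
    map_preact_eq_map_gaussianReal_normalizedSum hρ0 hρ,
    Measure.map_prod_map _ _ (by fun_prop) (by fun_prop), map_measureReal_apply (by fun_prop) hmeas,
    gProb_wVec_disagreeFrac hn]
  congr 1
  ext p
  simp only [Set.mem_preimage, Set.mem_ofPred_eq, Prod.map_fst, Prod.map_snd, abs_mul,
    abs_of_pos hs, abs_of_nonneg (Real.sqrt_nonneg _), mul_assoc, mul_le_mul_iff_right₀ hs, hC]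

theorem gProb_nonneg (w : ℝ × ℝ) (v : ℝ) : 0 ≤ gProb w v := measureReal_nonneg

theorem gProb_le_one (w : ℝ × ℝ) (v : ℝ) : gProb w v ≤ 1 := measureReal_le_one

theorem gProb_mem_unitInterval (w : ℝ × ℝ) (v : ℝ) : gProb w v ∈ unitInterval :=
  ⟨gProb_nonneg w v, gProb_le_one w v⟩

/-- The law of the private matrix of a layer. -/
abbrev privateLaw (n : ℕ) : Measure (Fin n → Fin n → ℝ) := Measure.pi fun _ => stdGaussianPi n

theorem eq_signBernoulli (μ : Measure ℤˣ) [IsProbabilityMeasure μ] :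
    μ = signBernoulli (1 - μ.real {-1}) := by
  have hmem : 1 - μ.real {-1} ∈ unitInterval :=
    Set.Icc.one_sub_mem ⟨measureReal_nonneg, measureReal_le_one⟩
  have := isProbabilityMeasure_signBernoulli hmem
  have hneg : μ.real {-1} = (signBernoulli (1 - μ.real {-1})).real {-1} := by
    rw [signBernoulli_real_singleton hmem, signVal_neg, signVal_one]
    ring
  have hcompl : ({1} : Set ℤˣ) = {-1}ᶜ := by
    ext u
    rcases Int.units_eq_one_or u with rfl | rfl <;> decide
  refine Measure.ext_of_singleton fun u => ?_
  rw [← measureReal_eq_measureReal_iff]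
  rcases Int.units_eq_one_or u with rfl | rfl
  · simp only [hcompl, probReal_compl_eq_one_sub (measurableSet_singleton _), ← hneg]
  · exact hneg

/-- The conditional law of `C_t` given the past and the shared vector. -/
theorem map_step_mul_step (hn : n ≠ 0) (hρ0 : 0 ≤ ρ) (hρ : ρ < 1) (ν : Fin n → ℝ) (x y : Cube n) :
    (privateLaw n).map (fun ψ => step ρ (ν, ψ) x * step ρ (ν, ψ) y) =
      cubeBernoulli n (1 - gProb (wVec ρ ν x y) (disagreeFrac x y)) := by
  set φ : (Fin n → ℝ) → ℤˣ := fun r =>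
    realSign (preact ρ Finset.univ ν r x) * realSign (preact ρ Finset.univ ν r y)
  have hφ : Measurable φ :=
    (measurable_of_countable fun p : ℤˣ × ℤˣ => p.1 * p.2).comp
      ((measurable_realSign.comp (measurable_preact ρ _ ν x)).prodMk
        (measurable_realSign.comp (measurable_preact ρ _ ν y)))
  have hprob := Measure.isProbabilityMeasure_map (μ := stdGaussianPi n) hφ.aemeasurable
  have hrow : (stdGaussianPi n).map φ =
      signBernoulli (1 - gProb (wVec ρ ν x y) (disagreeFrac x y)) := by
    rw [eq_signBernoulli ((stdGaussianPi n).map φ),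
      map_measureReal_apply hφ (measurableSet_singleton _),
      ← measureReal_realSign_preact_mul_eq_neg_one hn hρ0 hρ ν x y]
    rfl
  rw [cubeBernoulli, ← hrow, ← Measure.pi_map_pi fun _ => hφ.aemeasurable]
  rfl

end OneLayer

/-! ### The network as a Markov chain -/

section Network

variable {n : ℕ} {ρ : ℝ}

theorem integral_networkLaw_head_tail {F : Layer n × (ℕ → Layer n) → ℝ}
    (hF : Integrable F ((layerLaw n).prod (networkLaw n))) :
    ∫ Θ, F (Θ 0, fun t => Θ (t + 1)) ∂networkLaw n =
      ∫ L, ∫ Θ, F (L, Θ) ∂networkLaw n ∂layerLaw n := by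
  have h : MeasurePreserving (fun Θ : ℕ → Layer n => (Θ 0, fun t => Θ (t + 1))) (networkLaw n)
      ((layerLaw n).prod (networkLaw n)) := measurePreserving_infinitePi_head_tail _
  have hF' := hF.aestronglyMeasurable
  rw [← h.map_eq] at hF'
  rw [← integral_prod F hF, ← h.map_eq, integral_map h.measurable.aemeasurable hF']

theorem network_succ (ρ : ℝ) (m : ℕ) (h : BoolFun n) (Θ : ℕ → Layer n) (x : Cube n) :
    network ρ (m + 1) h Θ x = network ρ m h (fun t => Θ (t + 1)) (step ρ (Θ 0) x) := by
  rw [network, network, state_succ_eq_state_step]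

theorem ae_layerLaw_preact_ne_zero (n : ℕ) (hρ : ρ < 1) :
    ∀ᵐ L ∂layerLaw n, ∀ (x : Cube n) (i : Fin n), preact ρ Finset.univ L.1 (L.2 i) x ≠ 0 := by
  refine ae_all_iff.2 fun x => ae_all_iff.2 fun i => ?_
  have hmeas : MeasurableSet {L : Layer n | preact ρ Finset.univ L.1 (L.2 i) x ≠ 0} := by
    refine (measurableSet_eq_fun ?_ measurable_const).compl
    unfold preact
    fun_prop
  refine (Measure.ae_prod_iff_ae_ae hmeas).2 (ae_of_all _ fun ν => ?_)
  exact (measurePreserving_eval (fun _ : Fin n => stdGaussianPi n) i).quasiMeasurePreserving.ae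
    (ae_preact_univ_ne_zero i.pos.ne' hρ ν x)

theorem ae_network_odd (hρ : ρ < 1) (T : ℕ) {h : BoolFun n} (hh : h.Odd) :
    ∀ᵐ Θ ∂networkLaw n, (network ρ T h Θ).Odd := by
  have hne : ∀ᵐ Θ ∂networkLaw n, ∀ (t : ℕ) (x : Cube n) (i : Fin n),
      preact ρ Finset.univ (Θ t).1 ((Θ t).2 i) x ≠ 0 :=
    ae_all_iff.2 fun t => (measurePreserving_eval_infinitePi (fun _ : ℕ => layerLaw n)
      t).quasiMeasurePreserving.ae (ae_layerLaw_preact_ne_zero n hρ)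
  filter_upwards [hne] with Θ hΘ x
  have hstate (t : ℕ) : state ρ Θ (-x) t = -state ρ Θ x t := by
    induction t with
    | zero => rfl
    | succ t ih => rw [state_succ, state_succ, ih, step_neg_of_preact_ne_zero (hΘ t _)]
  rw [network, network, hstate, hh]

/-- The image of a pair of inputs under one layer. -/
def stepPair (ρ : ℝ) (L : Layer n) (p : Cube n × Cube n) : Cube n × Cube n :=
  (step ρ L p.1, step ρ L p.2)

@[fun_prop]
theorem measurable_stepPair (ρ : ℝ) (p : Cube n × Cube n) :
    Measurable fun L : Layer n => stepPair ρ L p :=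
  (measurable_step ρ p.1).prodMk (measurable_step ρ p.2)

theorem integrable_comp_stepPair (μ : Measure (Layer n)) [IsFiniteMeasure μ]
    (φ : Cube n × Cube n → ℝ) (p : Cube n × Cube n) : Integrable (fun L => φ (stepPair ρ L p)) μ :=
  (Integrable.of_finite (f := φ)).comp_measurable (measurable_stepPair ρ p)

theorem setIntegral_stepPair (φ : Cube n × Cube n → ℝ) (p : Cube n × Cube n)
    (s : Set (Fin n → ℝ)) :
    ∫ L in Prod.fst ⁻¹' s, φ (stepPair ρ L p) ∂layerLaw n =
      ∫ ν in s, ∫ ψ, φ (stepPair ρ (ν, ψ) p) ∂privateLaw n ∂stdGaussianPi n := by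
  have h := setIntegral_prod (μ := stdGaussianPi n) (ν := privateLaw n) (s := s) (t := Set.univ)
    (fun L => φ (stepPair ρ L p)) (integrable_comp_stepPair ((layerLaw n).restrict _) φ p)
  rw [Set.prod_univ, Measure.restrict_univ] at h
  exact h

end Network

/-! ### Correlation of the outputs -/

section OutputCorrelation

variable {n : ℕ} {ρ : ℝ}

/-- The expected product of the outputs at the two inputs, over the weights of the network. -/
def outputCorr (ρ : ℝ) (h : BoolFun n) (m : ℕ) (p : Cube n × Cube n) : ℝ :=
  ∫ Θ, signVal (network ρ m h Θ p.1) * signVal (network ρ m h Θ p.2) ∂networkLaw n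

theorem integrable_signVal_mul_signVal {Ω : Type*} [MeasurableSpace Ω] (μ : Measure Ω)
    [IsFiniteMeasure μ] {u v : Ω → ℤˣ} (hu : Measurable u) (hv : Measurable v) :
    Integrable (fun a => signVal (u a) * signVal (v a)) μ :=
  (Integrable.of_finite (f := fun q : ℤˣ × ℤˣ => signVal q.1 * signVal q.2)).comp_measurable
    (hu.prodMk hv)

theorem measurable_network_uncurry (ρ : ℝ) (m : ℕ) (h : BoolFun n) :
    Measurable fun q : (ℕ → Layer n) × Cube n => network ρ m h q.1 q.2 :=
  measurable_from_prod_countable_left fun x => measurable_pi_iff.1 (measurable_network ρ m h) x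

theorem outputCorr_le_one (ρ : ℝ) (h : BoolFun n) (m : ℕ) (p : Cube n × Cube n) :
    outputCorr ρ h m p ≤ 1 := by
  refine (le_abs_self _).trans ?_
  simpa [outputCorr] using norm_integral_le_of_norm_le_const (μ := networkLaw n) (C := 1)
    (ae_of_all _ fun Θ => (by simp [abs_signVal] :
      ‖signVal (network ρ m h Θ p.1) * signVal (network ρ m h Θ p.2)‖ ≤ 1))

theorem outputCorr_succ (ρ : ℝ) (h : BoolFun n) (m : ℕ) (p : Cube n × Cube n) :
    outputCorr ρ h (m + 1) p = ∫ L, outputCorr ρ h m (stepPair ρ L p) ∂layerLaw n := by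
  have hmeas (x : Cube n) : Measurable fun q : Layer n × (ℕ → Layer n) =>
      network ρ m h q.2 (step ρ q.1 x) :=
    (measurable_network_uncurry ρ m h).comp
      (measurable_snd.prodMk ((measurable_step ρ x).comp measurable_fst))
  simp only [outputCorr, network_succ]
  exact integral_networkLaw_head_tail
    (integrable_signVal_mul_signVal _ (hmeas p.1) (hmeas p.2))

/-- Flipping the signs of the columns of a layer. -/
def flipLayer (a : Cube n) (L : Layer n) : Layer n :=
  (fun j => signVal (a j) * L.1 j, fun i j => signVal (a j) * L.2 i j)

theorem measurePreserving_flipLayer (a : Cube n) :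
    MeasurePreserving (flipLayer a) (layerLaw n) (layerLaw n) := by
  have hcoord (u : ℤˣ) : (gaussianReal 0 1).map (fun t => signVal u * t) = gaussianReal 0 1 := by
    rw [gaussianReal_map_const_mul, mul_zero, mul_one]
    congr 1
    ext
    simp [sq, signVal_mul_self]
  have hrow : MeasurePreserving (fun (ν : Fin n → ℝ) j => signVal (a j) * ν j)
      (stdGaussianPi n) (stdGaussianPi n) :=
    measurePreserving_pi _ _ fun j => ⟨by fun_prop, hcoord _⟩
  exact hrow.prod (measurePreserving_pi _ _ fun _ => hrow)

theorem step_flipLayer (ρ : ℝ) (a : Cube n) (L : Layer n) (x : Cube n) :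
    step ρ (flipLayer a L) x = step ρ L (a * x) := by
  ext1 i
  simp only [step, preact, flipLayer, signedSum, Pi.mul_apply, signVal_mul]
  congr 4 <;> exact funext fun j => by ring

theorem outputCorr_succ_mul_left (ρ : ℝ) (h : BoolFun n) (m : ℕ) (a x y : Cube n) :
    outputCorr ρ h (m + 1) (a * x, a * y) = outputCorr ρ h (m + 1) (x, y) := by
  have hint := integrable_comp_stepPair (layerLaw n) (ρ := ρ) (outputCorr ρ h m) (x, y)
  have hmap := (measurePreserving_flipLayer a).map_eq
  rw [← hmap] at hint
  have hflip := integral_map (measurePreserving_flipLayer a).measurable.aemeasurable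
    hint.aestronglyMeasurable
  rw [hmap] at hflip
  rw [outputCorr_succ, outputCorr_succ, hflip]
  simp only [stepPair, step_flipLayer]

theorem outputCorr_succ_eq_one_left (ρ : ℝ) (h : BoolFun n) (m : ℕ) (x y : Cube n) :
    outputCorr ρ h (m + 1) (x, y) = outputCorr ρ h (m + 1) (1, x * y) := by
  rw [← outputCorr_succ_mul_left ρ h m x x y, Cube.mul_self]

theorem integral_outputCorr_noisyPair {ε : ℝ} (hε : ε ∈ unitInterval) (ρ : ℝ) (h : BoolFun n)
    (m : ℕ) :
    ∫ p, outputCorr ρ h m p ∂noisyPair n ε =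
      ∫ Θ, noiseStab ε (fun x => signVal (network ρ m h Θ x)) ∂networkLaw n := by
  have := isProbabilityMeasure_noisyPair n hε
  have hmeas {f : Cube n × Cube n → Cube n} (hf : Measurable f) :
      Measurable fun q : (Cube n × Cube n) × (ℕ → Layer n) => network ρ m h q.2 (f q.1) :=
    (measurable_network_uncurry ρ m h).comp (measurable_snd.prodMk (hf.comp measurable_fst))
  exact integral_integral_swap
    (integrable_signVal_mul_signVal _ (hmeas measurable_fst) (hmeas measurable_snd))

/-- The conditional probability `g_W(v)`, given the shared vector `ν`, that the images of a pair of
inputs differ at a given position. -/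
def flipProb (ρ : ℝ) (ν : Fin n → ℝ) (p : Cube n × Cube n) : ℝ :=
  gProb (wVec ρ ν p.1 p.2) (disagreeFrac p.1 p.2)

theorem flipProb_mem_unitInterval (ρ : ℝ) (ν : Fin n → ℝ) (p : Cube n × Cube n) :
    flipProb ρ ν p ∈ unitInterval :=
  gProb_mem_unitInterval _ _

theorem integral_outputCorr_stepPair (hn : n ≠ 0) (hρ0 : 0 ≤ ρ) (hρ : ρ < 1) (h : BoolFun n)
    (m : ℕ) (ν : Fin n → ℝ) (p : Cube n × Cube n) :
    ∫ ψ, outputCorr ρ h (m + 1) (stepPair ρ (ν, ψ) p) ∂privateLaw n =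
      ∫ q, outputCorr ρ h (m + 1) q ∂noisyPair n (flipProb ρ ν p) := by
  have hflip := Set.Icc.one_sub_mem (flipProb_mem_unitInterval ρ ν p)
  have := isProbabilityMeasure_cubeBernoulli n hflip
  have hmul : Measurable fun ψ : Fin n → Fin n → ℝ => step ρ (ν, ψ) p.1 * step ρ (ν, ψ) p.2 :=
    (measurable_of_countable fun q : Cube n × Cube n => q.1 * q.2).comp
      ((measurable_stepPair ρ p).comp measurable_prodMk_left)
  rw [noisyPair, integral_map (measurable_of_countable _).aemeasurable
    (measurable_of_countable _).aestronglyMeasurable, integral_prod _ .of_finite]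
  simp only [outputCorr_succ_eq_one_left ρ h m _ (_ * _), ← mul_assoc, Cube.mul_self, one_mul,
    integral_const, probReal_univ, one_smul]
  rw [flipProb, ← map_step_mul_step hn hρ0 hρ, integral_map hmul.aemeasurable
    (measurable_of_countable _).aestronglyMeasurable]
  simp only [stepPair, ← outputCorr_succ_eq_one_left]

theorem integral_outputCorr_stepPair_nonpos (hn : n ≠ 0) (hρ0 : 0 ≤ ρ) (hρ : ρ < 1)
    {h : BoolFun n} (hh : h.Odd) (m : ℕ) {ν : Fin n → ℝ} {p : Cube n × Cube n}
    (hflip : 1 / 2 ≤ flipProb ρ ν p) :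
    ∫ ψ, outputCorr ρ h (m + 1) (stepPair ρ (ν, ψ) p) ∂privateLaw n ≤ 0 := by
  have hmem := flipProb_mem_unitInterval ρ ν p
  rw [integral_outputCorr_stepPair hn hρ0 hρ, integral_outputCorr_noisyPair hmem]
  refine integral_nonpos_of_ae ?_
  filter_upwards [ae_network_odd hρ (m + 1) hh] with Θ hΘ
  refine noiseStab_nonpos_of_odd hflip hmem.2 fun x => ?_
  rw [hΘ, signVal_neg]

end OutputCorrelation

/-! ### Sub-Markov operators -/

section SubMarkov

variable {S : Type*} {P : Module.End ℝ (S → ℝ)} {D : Set S} {η b : ℝ}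

/-- A sub-Markov operator: the transition operator of a Markov chain on `S` that may be killed.
The function `(P ^ m) 1` gives the probabilities of surviving `m` steps. -/
structure IsSubMarkov (P : Module.End ℝ (S → ℝ)) : Prop where
  monotone : Monotone P
  map_one_le : P 1 ≤ 1

namespace IsSubMarkov

theorem monotone_pow (hP : IsSubMarkov P) (m : ℕ) : Monotone ⇑(P ^ m) := by
  rw [Module.End.coe_pow]
  exact hP.monotone.iterate m

theorem antitone_pow_one (hP : IsSubMarkov P) : Antitone fun m => (P ^ m) 1 :=
  antitone_nat_of_succ_le fun m => by
    rw [pow_succ, Module.End.mul_apply]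
    exact hP.monotone_pow m hP.map_one_le

theorem pow_one_le_one (hP : IsSubMarkov P) (m : ℕ) : (P ^ m) 1 ≤ 1 :=
  hP.antitone_pow_one (Nat.zero_le m)

theorem pow_indicator_le (hP : IsSubMarkov P) (hη : 0 ≤ η) (hD : ∀ p ∉ D, P (D.indicator 1) p ≤ η)
    (m : ℕ) : (P ^ m) (D.indicator 1) ≤ (m * η) • 1 + D.indicator 1 := by
  have hstep : P (D.indicator 1) ≤ η • 1 + D.indicator 1 := by
    intro p
    by_cases hp : p ∈ D
    · have h1 := (hP.monotone (Set.indicator_le_self' (s := D) (f := (1 : S → ℝ))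
        fun _ _ => zero_le_one) p).trans (hP.map_one_le p)
      simp only [Pi.one_apply] at h1
      simp [hp]
      linarith
    · simpa [hp] using hD p hp
  induction m with
  | zero => simp
  | succ m ih =>
    rw [pow_succ', Module.End.mul_apply]
    refine (hP.monotone ih).trans ?_
    rw [map_add, map_smul, Nat.cast_succ, add_mul, one_mul, add_smul, add_assoc]
    gcongr
    exact hP.map_one_le

/-- The summand `k * η / b` is the fixed point of `s ↦ k * η + s * (1 - b)`: in each block of `k`
steps the chain may enter `D`, with probability at most `k * η`, or else survive. -/
theorem pow_mul_one_le (hP : IsSubMarkov P) (hη : 0 ≤ η) (hb0 : 0 < b) (hb1 : b ≤ 1) (k : ℕ)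
    (hD : ∀ p ∉ D, P (D.indicator 1) p ≤ η) (hk : ∀ p ∉ D, (P ^ k) 1 p ≤ 1 - b) (j : ℕ)
    {p : S} (hp : p ∉ D) : (P ^ (k * j)) 1 p ≤ (1 - b) ^ j + k * η / b := by
  induction j generalizing p with
  | zero =>
    simp only [mul_zero, pow_zero, Module.End.one_apply, Pi.one_apply, le_add_iff_nonneg_right]
    positivity
  | succ j ih =>
    set s := (1 - b) ^ j + k * η / b with hs
    have hs0 : 0 ≤ s := add_nonneg (pow_nonneg (by linarith) _) (by positivity)
    have hle : (P ^ (k * j)) 1 ≤ D.indicator 1 + s • 1 := fun q => by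
      by_cases hq : q ∈ D
      · have := hP.pow_one_le_one (k * j) q
        simp only [Pi.one_apply] at this
        simp [hq]
        linarith
      · simpa [hq] using ih hq
    have hmerge : (P ^ k) (D.indicator 1) p ≤ k * η := by
      simpa [hp] using hP.pow_indicator_le hη hD k p
    calc (P ^ (k * (j + 1))) 1 p = (P ^ k) ((P ^ (k * j)) 1) p := by
          rw [mul_add_one, add_comm, pow_add, Module.End.mul_apply]
      _ ≤ (P ^ k) (D.indicator 1 + s • 1) p := hP.monotone_pow k hle p
      _ = (P ^ k) (D.indicator 1) p + s * (P ^ k) 1 p := by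
          rw [map_add, map_smul, Pi.add_apply, Pi.smul_apply, smul_eq_mul]
      _ ≤ k * η + s * (1 - b) := by gcongr; exact hk p hp
      _ = (1 - b) ^ (j + 1) + k * η / b := by
          rw [hs]
          field_simp
          ring

end IsSubMarkov

end SubMarkov

/-! ### The chain killed when `g ≥ 1/2` -/

section KilledChain

variable {n : ℕ} {ρ : ℝ} {p : Cube n × Cube n}

theorem measurable_gProb (v : ℝ) : Measurable fun w => gProb w v := by
  have hE : MeasurableSet {q : (ℝ × ℝ) × (ℝ × ℝ) |
      √(1 - v) * |q.1.2 + q.2.2| ≤ √v * |q.1.1 + q.2.1|} :=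
    measurableSet_le (by fun_prop) (by fun_prop)
  have hgauss (a : ℝ) : gaussianReal a 1 = (gaussianReal 0 1).map fun t => a + t := by
    rw [gaussianReal_map_const_add, zero_add]
  have hg (w : ℝ × ℝ) : gProb w v = ((gaussianReal 0 1).prod (gaussianReal 0 1)).real
      {q : ℝ × ℝ | √(1 - v) * |w.2 + q.2| ≤ √v * |w.1 + q.1|} := by
    rw [gProb, hgauss w.1, hgauss w.2, Measure.map_prod_map _ _ (by fun_prop) (by fun_prop),
      map_measureReal_apply (by fun_prop) (measurableSet_le (by fun_prop) (by fun_prop))]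
    rfl
  simp only [hg]
  exact (measurable_measure_prodMk_left hE).ennreal_toReal

theorem measurable_wVec (ρ : ℝ) (x y : Cube n) : Measurable fun ν => wVec ρ ν x y := by
  unfold wVec; fun_prop

theorem measurable_flipProb (ρ : ℝ) (p : Cube n × Cube n) :
    Measurable fun ν => flipProb ρ ν p :=
  (measurable_gProb _).comp (measurable_wVec ρ p.1 p.2)

/-- The event, in terms of the shared vector, that a pair of inputs is not killed. -/
def aliveSet (ρ : ℝ) (p : Cube n × Cube n) : Set (Fin n → ℝ) := {ν | flipProb ρ ν p < 1 / 2}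

theorem measurableSet_aliveSet (ρ : ℝ) (p : Cube n × Cube n) : MeasurableSet (aliveSet ρ p) :=
  measurableSet_lt (measurable_flipProb ρ p) measurable_const

/-- The transition operator of the chain of pairs of states, killed when `g ≥ 1/2`. -/
def killOp (ρ : ℝ) : Module.End ℝ (Cube n × Cube n → ℝ) where
  toFun φ p := ∫ L in Prod.fst ⁻¹' aliveSet ρ p, φ (stepPair ρ L p) ∂layerLaw n
  map_add' φ φ' := funext fun p =>
    integral_add (integrable_comp_stepPair _ φ p) (integrable_comp_stepPair _ φ' p)
  map_smul' c _ := funext fun _ => integral_const_mul c _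

theorem killOp_apply (ρ : ℝ) (φ : Cube n × Cube n → ℝ) (p : Cube n × Cube n) :
    killOp ρ φ p = ∫ L in Prod.fst ⁻¹' aliveSet ρ p, φ (stepPair ρ L p) ∂layerLaw n :=
  rfl

theorem isSubMarkov_killOp (n : ℕ) (ρ : ℝ) : IsSubMarkov (killOp (n := n) ρ) where
  monotone φ φ' h p := integral_mono (integrable_comp_stepPair _ φ p)
    (integrable_comp_stepPair _ φ' p) fun _ => h _
  map_one_le p := by
    simp only [killOp_apply, Pi.one_apply, setIntegral_const, smul_eq_mul, mul_one]
    exact measureReal_le_one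

/-- The probability that `g < 1/2` at each of the first `m` layers, for each pair of inputs. -/
def survProb (ρ : ℝ) (m : ℕ) : Cube n × Cube n → ℝ := (killOp ρ ^ m) 1

theorem survProb_zero (ρ : ℝ) (p : Cube n × Cube n) : survProb ρ 0 p = 1 := rfl

theorem survProb_succ (ρ : ℝ) (m : ℕ) :
    survProb ρ (m + 1) = killOp ρ (survProb (n := n) ρ m) := by
  rw [survProb, pow_succ', Module.End.mul_apply, survProb]

theorem survProb_le_one (ρ : ℝ) (m : ℕ) (p : Cube n × Cube n) : survProb ρ m p ≤ 1 :=
  (isSubMarkov_killOp n ρ).pow_one_le_one m p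

theorem antitone_survProb (ρ : ℝ) (p : Cube n × Cube n) : Antitone fun m => survProb ρ m p :=
  fun _ _ h => (isSubMarkov_killOp n ρ).antitone_pow_one h p

theorem outputCorr_add_two_le_killOp (hn : n ≠ 0) (hρ0 : 0 ≤ ρ) (hρ : ρ < 1) {h : BoolFun n}
    (hh : h.Odd) (m : ℕ) (p : Cube n × Cube n) :
    outputCorr ρ h (m + 2) p ≤ killOp ρ (outputCorr ρ h (m + 1)) p := by
  have hA := measurableSet_aliveSet ρ p
  rw [outputCorr_succ, ← integral_add_compl (measurable_fst hA) (integrable_comp_stepPair _ _ _),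
    ← Set.preimage_compl, setIntegral_stepPair _ _ (aliveSet ρ p)ᶜ, killOp_apply,
    add_le_iff_nonpos_right]
  exact setIntegral_nonpos hA.compl fun ν hν =>
    integral_outputCorr_stepPair_nonpos hn hρ0 hρ hh m (not_lt.1 hν)

theorem outputCorr_succ_le_survProb (hn : n ≠ 0) (hρ0 : 0 ≤ ρ) (hρ : ρ < 1) {h : BoolFun n}
    (hh : h.Odd) (m : ℕ) : outputCorr ρ h (m + 1) ≤ survProb ρ m := by
  induction m with
  | zero => exact outputCorr_le_one ρ h 1
  | succ m ih =>
    rw [survProb_succ]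
    exact fun p => (outputCorr_add_two_le_killOp hn hρ0 hρ hh m p).trans
      ((isSubMarkov_killOp n ρ).monotone ih p)

/-- The event that `g < 1/2` at each of the first `m` layers. -/
def noHit (ρ : ℝ) (m : ℕ) (p : Cube n × Cube n) : Set (ℕ → Layer n) :=
  {Θ | ∀ s < m, (Θ s).1 ∈ aliveSet ρ (state ρ Θ p.1 s, state ρ Θ p.2 s)}

theorem measurableSet_uncurry_aliveSet (ρ : ℝ) :
    MeasurableSet {q : (Fin n → ℝ) × (Cube n × Cube n) | q.1 ∈ aliveSet ρ q.2} :=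
  measurableSet_setOfPred.2 (measurable_from_prod_countable_left fun p =>
    (measurableSet_aliveSet ρ p).mem)

theorem measurableSet_noHit (ρ : ℝ) (m : ℕ) (p : Cube n × Cube n) :
    MeasurableSet (noHit ρ m p) := by
  simp only [noHit, Set.ofPred_forall]
  refine .iInter fun s => .iInter fun _ => ?_
  have hmeas : Measurable fun Θ : ℕ → Layer n =>
      ((Θ s).1, (state ρ Θ p.1 s, state ρ Θ p.2 s)) :=
    (measurable_fst.comp (measurable_pi_apply s)).prodMk
      ((measurable_state ρ p.1 s).prodMk (measurable_state ρ p.2 s))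
  exact hmeas (measurableSet_uncurry_aliveSet ρ)

theorem mem_noHit_succ {m : ℕ} {Θ : ℕ → Layer n} :
    Θ ∈ noHit ρ (m + 1) p ↔
      (Θ 0).1 ∈ aliveSet ρ p ∧ (fun t => Θ (t + 1)) ∈ noHit ρ m (stepPair ρ (Θ 0) p) := by
  simp only [noHit, Set.mem_ofPred_eq, Nat.forall_lt_succ_left, state_succ_eq_state_step, stepPair]
  rfl

theorem networkLaw_real_noHit_succ (ρ : ℝ) (m : ℕ) (p : Cube n × Cube n) :
    (networkLaw n).real (noHit ρ (m + 1) p) =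
      killOp ρ (fun q => (networkLaw n).real (noHit ρ m q)) p := by
  set S : Set (Layer n × (ℕ → Layer n)) :=
    {q | q.1.1 ∈ aliveSet ρ p ∧ q.2 ∈ noHit ρ m (stepPair ρ q.1 p)}
  have hnoHit : MeasurableSet {q : (ℕ → Layer n) × (Cube n × Cube n) | q.1 ∈ noHit ρ m q.2} :=
    measurableSet_setOfPred.2 (measurable_from_prod_countable_left fun q =>
      (measurableSet_noHit ρ m q).mem)
  have hS : MeasurableSet S :=
    (measurable_fst.comp measurable_fst (measurableSet_aliveSet ρ p)).inter
      ((measurable_snd.prodMk ((measurable_stepPair ρ p).comp measurable_fst)) hnoHit)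
  have hpre : noHit ρ (m + 1) p = (fun Θ => (Θ 0, fun t => Θ (t + 1))) ⁻¹' S :=
    Set.ext fun _ => mem_noHit_succ
  have hA : MeasurableSet (Prod.fst ⁻¹' aliveSet ρ p : Set (Layer n)) :=
    measurable_fst (measurableSet_aliveSet ρ p)
  rw [← integral_indicator_one (measurableSet_noHit ρ (m + 1) p), killOp_apply,
    ← integral_indicator hA, hpre]
  refine (integral_networkLaw_head_tail ((integrable_const (1 : ℝ)).indicator hS)).trans ?_
  congr 1 with L
  by_cases hL : L ∈ Prod.fst ⁻¹' aliveSet ρ p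
  · rw [Set.indicator_of_mem hL, ← integral_indicator_one (measurableSet_noHit ρ m _)]
    have hsection : Prod.mk L ⁻¹' S = noHit ρ m (stepPair ρ L p) :=
      Set.ext fun _ => and_iff_right hL
    rw [← hsection]
    rfl
  · have hmem (Θ : ℕ → Layer n) : (L, Θ) ∉ S := fun h => hL h.1
    simp only [Set.indicator_of_notMem hL, Set.indicator_of_notMem (hmem _), integral_zero]

theorem networkLaw_real_noHit (ρ : ℝ) (m : ℕ) (p : Cube n × Cube n) :
    (networkLaw n).real (noHit ρ m p) = survProb ρ m p := by
  induction m generalizing p with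
  | zero => simp [noHit, survProb_zero]
  | succ m ih => simp only [networkLaw_real_noHit_succ, ih, survProb_succ]

end KilledChain

/-! ### Gaussian estimates -/

section GaussianEstimates

variable {v : NNReal} {w a b B : ℝ}

theorem exp_le_gaussianPDFReal (hv : v ≠ 0) {y : ℝ} (h : |y - w| ≤ B) :
    Real.exp (-(B ^ 2 / (2 * v))) / (3 * √v) ≤ gaussianPDFReal w v y := by
  have : (0 : ℝ) < v := by positivity
  have hB : (y - w) ^ 2 ≤ B ^ 2 := sq_le_sq' (abs_le.1 h).1 (abs_le.1 h).2
  have h3 : √(2 * Real.pi * v) ≤ 3 * √v := by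
    rw [Real.sqrt_mul (by positivity)]
    gcongr
    rw [Real.sqrt_le_left (by norm_num)]
    linarith [Real.pi_lt_d2]
  rw [gaussianPDFReal, ← div_eq_inv_mul, neg_div]
  gcongr

theorem sub_mul_exp_le_gaussianReal_real_Icc (hv : v ≠ 0) (hab : a ≤ b)
    (h : ∀ y ∈ Set.Icc a b, |y - w| ≤ B) :
    (b - a) * (Real.exp (-(B ^ 2 / (2 * v))) / (3 * √v)) ≤
      (gaussianReal w v).real (Set.Icc a b) := by
  have h0 : 0 ≤ ∫ y in Set.Icc a b, gaussianPDFReal w v y :=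
    integral_nonneg fun y => gaussianPDFReal_nonneg _ _ _
  rw [Measure.real, gaussianReal_apply_eq_integral w hv, ENNReal.toReal_ofReal h0]
  calc (b - a) * (Real.exp (-(B ^ 2 / (2 * v))) / (3 * √v))
      = ∫ _ in Set.Icc a b, Real.exp (-(B ^ 2 / (2 * v))) / (3 * √v) := by
        rw [setIntegral_const, Real.volume_real_Icc_of_le hab, smul_eq_mul]
    _ ≤ _ := setIntegral_mono_on (integrableOn_const (by simp))
        (integrable_gaussianPDFReal _ _).integrableOn measurableSet_Icc
        fun y hy => exp_le_gaussianPDFReal hv (h y hy)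

theorem two_mul_exp_le_gaussianReal_real_abs_le (hv : v ≠ 0) (ha : 0 ≤ a) (h : |w| + a ≤ B) :
    2 * a * (Real.exp (-(B ^ 2 / (2 * v))) / (3 * √v)) ≤ (gaussianReal w v).real {y | |y| ≤ a} := by
  have hs : {y : ℝ | |y| ≤ a} = Set.Icc (-a) a := by
    simp only [abs_le]
    rfl
  rw [hs, two_mul, ← sub_neg_eq_add a a]
  refine sub_mul_exp_le_gaussianReal_real_Icc hv (by linarith) fun y hy => ?_
  linarith [abs_sub y w, abs_le.2 hy]

theorem exp_le_gaussianReal_real_le_abs (hv : v ≠ 0) (w : ℝ) (ha : 0 ≤ a) :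
    Real.exp (-((a + √v) ^ 2 / (2 * v))) / 3 ≤ (gaussianReal w v).real {x | a ≤ |x|} := by
  have hsv : 0 < √(v : ℝ) := Real.sqrt_pos.2 (by positivity)
  have hlen : Real.exp (-((a + √v) ^ 2 / (2 * v))) / 3 =
      √v * (Real.exp (-((a + √v) ^ 2 / (2 * v))) / (3 * √v)) := by
    field_simp
  rw [hlen]
  rcases le_total 0 w with hw | hw
  · have h := sub_mul_exp_le_gaussianReal_real_Icc hv (w := w) (a := w + a) (b := w + a + √v)
      (B := a + √v) (by linarith) fun y hy => abs_le.2 ⟨by linarith [hy.1], by linarith [hy.2]⟩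
    rw [add_sub_cancel_left] at h
    exact h.trans (measureReal_mono fun y hy => show a ≤ |y| from
      le_abs.2 (Or.inl (by linarith [hy.1])))
  · have h := sub_mul_exp_le_gaussianReal_real_Icc hv (w := w) (a := w - a - √v) (b := w - a)
      (B := a + √v) (by linarith) fun y hy => abs_le.2 ⟨by linarith [hy.1], by linarith [hy.2]⟩
    rw [sub_sub_cancel] at h
    exact h.trans (measureReal_mono fun y hy => show a ≤ |y| from
      le_abs.2 (Or.inr (by linarith [hy.2])))

theorem three_quarters_le_gaussianReal_real_abs_sub_lt_two (w : ℝ) :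
    3 / 4 ≤ (gaussianReal w 1).real {x | |x - w| < 2} := by
  have hcheb := meas_ge_le_variance_div_sq (memLp_id_gaussianReal (μ := w) (v := 1) 2)
    (c := 2) (by norm_num)
  simp only [variance_id_gaussianReal, id, integral_id_gaussianReal, NNReal.coe_one] at hcheb
  have htail : (gaussianReal w 1).real {x | 2 ≤ |x - w|} ≤ 1 / 4 :=
    ENNReal.toReal_le_of_le_ofReal (by norm_num) (hcheb.trans_eq (by norm_num))
  have hcompl : {x : ℝ | |x - w| < 2} = {x | 2 ≤ |x - w|}ᶜ := by
    ext x
    simp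
  rw [hcompl, probReal_compl_eq_one_sub (measurableSet_le (by fun_prop) (by fun_prop))]
  linarith

theorem hasSubgaussianMGF_id_gaussianReal (v : NNReal) :
    HasSubgaussianMGF id v (gaussianReal 0 v) where
  integrable_exp_mul := integrable_exp_mul_gaussianReal
  mgf_le t := by simp [mgf_id_gaussianReal]

theorem gaussianReal_real_le_abs_le (v : NNReal) (ha : 0 ≤ a) :
    (gaussianReal 0 v).real {x | a ≤ |x|} ≤ 2 * Real.exp (-a ^ 2 / (2 * v)) := by
  have hsub : {x : ℝ | a ≤ |x|} ⊆ {x | a ≤ id x} ∪ {x | a ≤ (-id) x} :=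
    fun x (hx : a ≤ |x|) => le_abs.1 hx
  calc (gaussianReal 0 v).real {x | a ≤ |x|}
      ≤ (gaussianReal 0 v).real {x | a ≤ id x} + (gaussianReal 0 v).real {x | a ≤ (-id) x} :=
        (measureReal_mono hsub).trans (measureReal_union_le _ _)
    _ ≤ Real.exp (-a ^ 2 / (2 * v)) + Real.exp (-a ^ 2 / (2 * v)) :=
        add_le_add ((hasSubgaussianMGF_id_gaussianReal v).measure_ge_le ha)
          ((hasSubgaussianMGF_id_gaussianReal v).neg.measure_ge_le ha)
    _ = _ := (two_mul _).symm

end GaussianEstimates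

/-! ### Lower bounds for `g` -/

section LowerBounds

variable {w : ℝ × ℝ} {v : ℝ}

theorem gProb_one (w : ℝ × ℝ) : gProb w 1 = 1 := by
  simp [gProb]

theorem gaussianReal_real_mul_le_gProb (w : ℝ × ℝ) (A : ℝ) (hv : 0 ≤ v) :
    (gaussianReal w.1 1).real {x | A ≤ |x|} * (gaussianReal w.2 1).real {y | |y| ≤ A * √v} ≤
      gProb w v := by
  rw [← measureReal_prod_prod, gProb]
  refine measureReal_mono fun p ⟨(hx : A ≤ |p.1|), (hy : |p.2| ≤ A * √v)⟩ => ?_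
  have hsqrt : √(1 - v) ≤ 1 := Real.sqrt_le_one.2 (by linarith)
  calc √(1 - v) * |p.2| ≤ 1 * |p.2| := by gcongr
    _ ≤ A * √v := by rw [one_mul]; exact hy
    _ ≤ √v * |p.1| := by rw [mul_comm]; gcongr

theorem exp_mul_sqrt_le_gProb (w : ℝ × ℝ) (hv : v ∈ unitInterval) :
    2 * Real.exp (-3) / 9 * √v * Real.exp (-w.2 ^ 2) ≤ gProb w v := by
  have hv1 : √v ≤ 1 := Real.sqrt_le_one.2 hv.2
  have hX := exp_le_gaussianReal_real_le_abs one_ne_zero w.1 zero_le_one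
  have hY := two_mul_exp_le_gaussianReal_real_abs_le one_ne_zero (w := w.2) (a := 1 * √v)
    (B := |w.2| + 1) (by positivity) (by linarith)
  simp only [NNReal.coe_one, Real.sqrt_one, mul_one] at hX hY
  have hexp : Real.exp (-3) * Real.exp (-w.2 ^ 2) ≤
      Real.exp (-((1 + 1) ^ 2 / 2)) * Real.exp (-((|w.2| + 1) ^ 2 / 2)) := by
    rw [← Real.exp_add, ← Real.exp_add, Real.exp_le_exp]
    linarith [sq_nonneg (|w.2| - 1), sq_abs w.2]
  calc 2 * Real.exp (-3) / 9 * √v * Real.exp (-w.2 ^ 2)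
      = 2 / 9 * √v * (Real.exp (-3) * Real.exp (-w.2 ^ 2)) := by ring
    _ ≤ 2 / 9 * √v *
        (Real.exp (-((1 + 1) ^ 2 / 2)) * Real.exp (-((|w.2| + 1) ^ 2 / 2))) := by gcongr
    _ = Real.exp (-((1 + 1) ^ 2 / 2)) / 3 *
        (2 * (1 * √v) * (Real.exp (-((|w.2| + 1) ^ 2 / 2)) / 3)) := by ring
    _ ≤ (gaussianReal w.1 1).real {x | 1 ≤ |x|} *
        (gaussianReal w.2 1).real {y | |y| ≤ 1 * √v} := by gcongr
    _ ≤ gProb w v := gaussianReal_real_mul_le_gProb w 1 hv.1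

/-- If `|w₁|` exceeds this constant by `2` and `|w₂| ≤ 1`, then `g_w(v) ≥ min(4√v, 1/2)`. -/
def pushConst : ℝ := 8 * Real.exp 8

theorem eight_le_pushConst : 8 ≤ pushConst :=
  le_mul_of_one_le_right (by norm_num) (Real.one_le_exp (by norm_num))

theorem three_quarters_mul_le_gProb (hv : 0 ≤ v) (h1 : pushConst + 2 ≤ |w.1|) :
    3 / 4 * (gaussianReal w.2 1).real {y | |y| ≤ pushConst * √v} ≤ gProb w v := by
  refine le_trans ?_ (gaussianReal_real_mul_le_gProb w pushConst hv)
  gcongr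
  refine (three_quarters_le_gaussianReal_real_abs_sub_lt_two w.1).trans
    (measureReal_mono fun x (hx : |x - w.1| < 2) => ?_)
  rw [Set.mem_ofPred_eq]
  linarith [abs_sub_abs_le_abs_sub w.1 x, abs_sub_comm w.1 x]

theorem half_le_gProb (hv : 0 ≤ v) (h1 : pushConst + 2 ≤ |w.1|) (h2 : |w.2| ≤ 1)
    (h3 : 3 ≤ pushConst * √v) : 1 / 2 ≤ gProb w v := by
  have hY : 3 / 4 ≤ (gaussianReal w.2 1).real {y | |y| ≤ pushConst * √v} := by
    refine (three_quarters_le_gaussianReal_real_abs_sub_lt_two w.2).trans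
      (measureReal_mono fun y (hy : |y - w.2| < 2) => ?_)
    rw [Set.mem_ofPred_eq]
    linarith [abs_sub_abs_le_abs_sub y w.2]
  linarith [three_quarters_mul_le_gProb hv h1]

theorem four_mul_sqrt_le_gProb (hv : 0 ≤ v) (h1 : pushConst + 2 ≤ |w.1|) (h2 : |w.2| ≤ 1)
    (hg : gProb w v < 1 / 2) : 4 * √v ≤ gProb w v := by
  have h3 : pushConst * √v < 3 := lt_of_not_ge fun h => hg.not_ge (half_le_gProb hv h1 h2 h)
  have hpos := eight_le_pushConst
  have hY := two_mul_exp_le_gaussianReal_real_abs_le one_ne_zero (w := w.2) (a := pushConst * √v)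
    (B := 4) (by positivity) (by linarith)
  simp only [NNReal.coe_one, Real.sqrt_one, mul_one] at hY
  have hexp : Real.exp 8 * Real.exp (-(4 ^ 2 / 2)) = 1 := by
    rw [← Real.exp_add]
    norm_num
  calc 4 * √v = 4 * √v * (Real.exp 8 * Real.exp (-(4 ^ 2 / 2))) := by rw [hexp, mul_one]
    _ = 3 / 4 * (2 * (pushConst * √v) * (Real.exp (-(4 ^ 2 / 2)) / 3)) := by
      rw [pushConst]; ring
    _ ≤ 3 / 4 * (gaussianReal w.2 1).real {y | |y| ≤ pushConst * √v} := by gcongr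
    _ ≤ gProb w v := three_quarters_mul_le_gProb hv h1

end LowerBounds

/-! ### Disagreements after one layer -/

section Disagreements

variable {n : ℕ} {ρ : ℝ} {x y : Cube n} {p : Cube n × Cube n}

theorem mgf_card_disagree_one (n : ℕ) {q : ℝ} (hq : q ∈ unitInterval) (t : ℝ) :
    mgf (fun z => ((disagree z 1).card : ℝ)) (cubeBernoulli n q) t =
      (q + (1 - q) * Real.exp t) ^ n := by
  have := isProbabilityMeasure_signBernoulli hq
  have hsign : (Finset.univ : Finset ℤˣ) = {1, -1} := rfl
  have hne : (-1 : ℤˣ) ≠ 1 := by decide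
  have hexp (z : Cube n) : Real.exp (t * (disagree z 1).card) =
      ∏ i, if z i ≠ 1 then Real.exp t else 1 := by
    rw [mul_comm, Real.exp_nat_mul, disagree, ← Finset.prod_const, Finset.prod_filter]
    rfl
  simp only [mgf, hexp]
  rw [cubeBernoulli,
    integral_fintype_prod_eq_prod (𝕜 := ℝ) fun _ u => if u ≠ (1 : ℤˣ) then Real.exp t else 1,
    Finset.prod_const, integral_fintype Integrable.of_finite, hsign, Finset.sum_pair hne.symm,
    signBernoulli_real_singleton hq, signBernoulli_real_singleton hq, Finset.card_univ,
    Fintype.card_fin]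
  simp [hne]
  ring

theorem cubeBernoulli_real_card_disagree_one_le (n : ℕ) {g : ℝ} (hg : g ∈ unitInterval) :
    (cubeBernoulli n (1 - g)).real {z | ((disagree z 1).card : ℝ) ≤ n * g / 4} ≤
      Real.exp (-(n * g / 4)) := by
  have hg' := Set.Icc.one_sub_mem hg
  have := isProbabilityMeasure_cubeBernoulli n hg'
  have hhalf : Real.exp (-1) ≤ 1 / 2 := by linarith [Real.exp_neg_one_lt_half]
  have hbase : 1 - g + (1 - (1 - g)) * Real.exp (-1) ≤ Real.exp (-(g / 2)) :=
    calc 1 - g + (1 - (1 - g)) * Real.exp (-1) ≤ 1 - g / 2 := by nlinarith [hg.1]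
      _ ≤ Real.exp (-(g / 2)) := Real.one_sub_le_exp_neg _
  have hbase0 : 0 ≤ 1 - g + (1 - (1 - g)) * Real.exp (-1) := by
    have := hg.1
    rw [sub_sub_cancel]
    exact add_nonneg hg'.1 (by positivity)
  calc (cubeBernoulli n (1 - g)).real {z | ((disagree z 1).card : ℝ) ≤ n * g / 4}
      ≤ Real.exp (-(-1) * (n * g / 4)) * (1 - g + (1 - (1 - g)) * Real.exp (-1)) ^ n := by
        rw [← mgf_card_disagree_one n hg']
        exact measure_le_le_exp_mul_mgf _ (by norm_num) Integrable.of_finite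
    _ ≤ Real.exp (-(-1) * (n * g / 4)) * Real.exp (-(g / 2)) ^ n := by gcongr
    _ = Real.exp (-(n * g / 4)) := by
        rw [← Real.exp_nat_mul, ← Real.exp_add]
        ring_nf

theorem disagree_mul_one (x y : Cube n) : disagree (x * y) 1 = disagree x y := by
  ext i
  have h : x i * y i = 1 ↔ x i = y i := by
    rw [mul_eq_one_iff_eq_inv, Int.units_inv_eq_self]
  simp [disagree, h]

theorem measurable_stepPair_right (ρ : ℝ) (ν : Fin n → ℝ) (p : Cube n × Cube n) :
    Measurable fun ψ => stepPair ρ (ν, ψ) p :=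
  (measurable_stepPair ρ p).comp measurable_prodMk_left

theorem privateLaw_real_card_disagree_le (hn : n ≠ 0) (hρ0 : 0 ≤ ρ) (hρ : ρ < 1) (ν : Fin n → ℝ)
    (p : Cube n × Cube n) :
    (privateLaw n).real {ψ | ((disagree (stepPair ρ (ν, ψ) p).1 (stepPair ρ (ν, ψ) p).2).card : ℝ) ≤
      n * flipProb ρ ν p / 4} ≤ Real.exp (-(n * flipProb ρ ν p / 4)) := by
  have hmeas : Measurable fun ψ => step ρ (ν, ψ) p.1 * step ρ (ν, ψ) p.2 :=
    (measurable_of_countable fun q : Cube n × Cube n => q.1 * q.2).comp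
      (measurable_stepPair_right ρ ν p)
  have h := cubeBernoulli_real_card_disagree_one_le n (flipProb_mem_unitInterval ρ ν p)
  rw [flipProb, ← map_step_mul_step hn hρ0 hρ ν p.1 p.2,
    map_measureReal_apply hmeas (Set.toFinite _).measurableSet] at h
  simp only [Set.preimage, Set.mem_ofPred_eq, disagree_mul_one] at h
  exact h

theorem disagreeFrac_mem_unitInterval (x y : Cube n) : disagreeFrac x y ∈ unitInterval := by
  refine ⟨by unfold disagreeFrac; positivity, div_le_one_of_le₀ ?_ (by positivity)⟩
  exact_mod_cast (Finset.card_le_univ _).trans_eq (Fintype.card_fin n)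

theorem disagree_nonempty_iff : (disagree x y).Nonempty ↔ x ≠ y := by
  simp [disagree, Finset.filter_nonempty_iff, Function.ne_iff]

theorem inv_le_disagreeFrac (hxy : x ≠ y) : 1 / (n : ℝ) ≤ disagreeFrac x y := by
  unfold disagreeFrac
  gcongr
  exact_mod_cast (disagree_nonempty_iff.2 hxy).card_pos

theorem aliveSet_eq_empty (hn : n ≠ 0) (ρ : ℝ) (h : (disagree p.1 p.2)ᶜ = ∅) :
    aliveSet ρ p = ∅ := by
  have hfrac : disagreeFrac p.1 p.2 = 1 := by
    simp [disagreeFrac, (Finset.compl_eq_empty_iff _).1 h, hn]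
  refine Set.eq_empty_of_forall_notMem fun ν (hν : flipProb ρ ν p < 1 / 2) => ?_
  rw [flipProb, hfrac, gProb_one] at hν
  norm_num at hν

end Disagreements

/-! ### The shared Gaussian sums -/

section SharedSums

variable {n : ℕ} {p : Cube n × Cube n}

/-- The variance of the two coordinates of `W_t`, that is `ρ/(1-ρ)` for `0 ≤ ρ < 1`. -/
def sharedVar (ρ : ℝ) : NNReal := (ρ / (1 - ρ)).toNNReal

theorem measurable_normalizedSum (ρ : ℝ) (s : Finset (Fin n)) (x : Cube n) :
    Measurable (normalizedSum ρ s x) := by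
  unfold normalizedSum; fun_prop

theorem map_normalizedSum (ρ : ℝ) {s : Finset (Fin n)} (hs : s.Nonempty) (x : Cube n) :
    (stdGaussianPi n).map (normalizedSum ρ s x) = gaussianReal 0 (sharedVar ρ) := by
  have hs' : (s.card : ℝ) ≠ 0 := by exact_mod_cast hs.card_ne_zero
  have hcomp : normalizedSum ρ s x =
      (fun t => √(ρ / (1 - ρ)) / √(s.card : ℝ) * t) ∘ signedSum s x := by
    ext ν
    simp only [normalizedSum, Function.comp_apply]
    ring
  rw [hcomp, ← Measure.map_map (by fun_prop) (by fun_prop), map_signedSum,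
    gaussianReal_map_const_mul, mul_zero]
  congr 1
  ext
  simp [sharedVar, div_pow, hs', Real.sq_sqrt', Real.coe_toNNReal']

theorem stdGaussianPi_real_wVec_mem (ρ : ℝ) (hp : (disagree p.1 p.2).Nonempty)
    (hp' : (disagree p.1 p.2)ᶜ.Nonempty) {A B : Set ℝ} (hA : MeasurableSet A)
    (hB : MeasurableSet B) :
    (stdGaussianPi n).real ((fun ν => wVec ρ ν p.1 p.2) ⁻¹' A ×ˢ B) =
      (gaussianReal 0 (sharedVar ρ)).real A * (gaussianReal 0 (sharedVar ρ)).real B := by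
  have hindep : IndepFun (normalizedSum ρ (disagree p.1 p.2) p.1)
      (normalizedSum ρ (disagree p.1 p.2)ᶜ p.1) (stdGaussianPi n) :=
    (indepFun_signedSum_compl (disagree p.1 p.2) p.1).comp
      (φ := fun t => √(ρ / (1 - ρ)) * (t / √((disagree p.1 p.2).card : ℝ)))
      (ψ := fun t => √(ρ / (1 - ρ)) * (t / √((disagree p.1 p.2)ᶜ.card : ℝ)))
      (by fun_prop) (by fun_prop)
  rw [← map_normalizedSum ρ hp p.1,
    map_measureReal_apply (measurable_normalizedSum ρ _ _) hA, map_normalizedSum ρ hp p.1,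
    ← map_normalizedSum ρ hp' p.1, map_measureReal_apply (measurable_normalizedSum ρ _ _) hB,
    measureReal_def, measureReal_def, measureReal_def, ← ENNReal.toReal_mul,
    ← hindep.measure_inter_preimage_eq_mul A B hA hB]
  simp only [wVec_eq]
  rfl

end SharedSums

/-! ### One step of the killed chain -/

section OneStepBounds

variable {n : ℕ} {ρ a b c : ℝ} {φ : Cube n × Cube n → ℝ} {p : Cube n × Cube n}

theorem integral_le_of_forall_mem_of_forall_notMem {Ω : Type*} [MeasurableSpace Ω] {μ : Measure Ω}
    [IsProbabilityMeasure μ] {f : Ω → ℝ} {E : Set Ω} (hE : MeasurableSet E) (hf : Integrable f μ)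
    (ha : ∀ x ∈ E, f x ≤ a) (hb : ∀ x ∉ E, f x ≤ b) :
    ∫ x, f x ∂μ ≤ μ.real E * a + (1 - μ.real E) * b := by
  rw [← integral_add_compl hE hf, ← probReal_compl_eq_one_sub hE, ← smul_eq_mul, ← smul_eq_mul,
    ← setIntegral_const, ← setIntegral_const]
  exact add_le_add
    (setIntegral_mono_on hf.integrableOn (integrableOn_const (by simp)) hE ha)
    (setIntegral_mono_on hf.integrableOn (integrableOn_const (by simp)) hE.compl hb)

theorem killOp_le_of_forall_mem_of_forall_notMem {E : Set (Fin n → ℝ)} (hE : MeasurableSet E)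
    (ha0 : 0 ≤ a) (hb0 : 0 ≤ b)
    (ha : ∀ ν ∈ E, ν ∈ aliveSet ρ p → ∫ ψ, φ (stepPair ρ (ν, ψ) p) ∂privateLaw n ≤ a)
    (hb : ∀ ν ∉ E, ν ∈ aliveSet ρ p → ∫ ψ, φ (stepPair ρ (ν, ψ) p) ∂privateLaw n ≤ b) :
    killOp ρ φ p ≤ (stdGaussianPi n).real E * a + (1 - (stdGaussianPi n).real E) * b := by
  have hA := measurableSet_aliveSet ρ p
  have hint : Integrable (fun ν => ∫ ψ, φ (stepPair ρ (ν, ψ) p) ∂privateLaw n)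
      (stdGaussianPi n) :=
    Integrable.integral_prod_left (integrable_comp_stepPair (layerLaw n) φ p)
  rw [killOp_apply, setIntegral_stepPair, ← integral_indicator hA]
  refine integral_le_of_forall_mem_of_forall_notMem hE (hint.indicator hA) (fun ν hν => ?_)
    fun ν hν => ?_
  · exact Set.indicator_apply_le' (ha ν hν) fun _ => ha0
  · exact Set.indicator_apply_le' (hb ν hν) fun _ => hb0

theorem killOp_eq_zero (hn : n ≠ 0) (ρ : ℝ) (φ : Cube n × Cube n → ℝ)
    (h : (disagree p.1 p.2)ᶜ = ∅) : killOp ρ φ p = 0 := by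
  rw [killOp_apply, aliveSet_eq_empty hn ρ h, Set.preimage_empty, setIntegral_empty]

theorem integral_stepPair_le_one (hφ : φ ≤ 1) (ρ : ℝ) (ν : Fin n → ℝ) (p : Cube n × Cube n) :
    ∫ ψ, φ (stepPair ρ (ν, ψ) p) ∂privateLaw n ≤ 1 := by
  have hint : Integrable (fun ψ => φ (stepPair ρ (ν, ψ) p)) (privateLaw n) :=
    (Integrable.of_finite (f := φ)).comp_measurable (measurable_stepPair_right ρ ν p)
  calc ∫ ψ, φ (stepPair ρ (ν, ψ) p) ∂privateLaw n ≤ ∫ _, (1 : ℝ) ∂privateLaw n :=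
        integral_mono hint (integrable_const _) fun ψ => hφ _
    _ = 1 := by simp

theorem integral_stepPair_indicator_diagonal_le (hn : n ≠ 0) (hρ0 : 0 ≤ ρ) (hρ : ρ < 1)
    (ν : Fin n → ℝ) (p : Cube n × Cube n) :
    ∫ ψ, (Set.diagonal (Cube n)).indicator 1 (stepPair ρ (ν, ψ) p) ∂privateLaw n ≤
      Real.exp (-(n * flipProb ρ ν p / 4)) := by
  have hmeas : MeasurableSet ((fun ψ => stepPair ρ (ν, ψ) p) ⁻¹' Set.diagonal (Cube n)) :=
    measurable_stepPair_right ρ ν p (Set.toFinite _).measurableSet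
  refine (integral_indicator_one hmeas).trans_le ?_
  refine (measureReal_mono fun ψ hψ => ?_).trans
    (privateLaw_real_card_disagree_le hn hρ0 hρ ν p)
  have hcard : (disagree (stepPair ρ (ν, ψ) p).1 (stepPair ρ (ν, ψ) p).2).card = 0 := by
    simp [disagree, Set.mem_diagonal_iff.1 hψ]
  have hflip := (flipProb_mem_unitInterval ρ ν p).1
  rw [Set.mem_ofPred_eq, hcard, Nat.cast_zero]
  positivity

theorem killOp_indicator_diagonal_le (hn : n ≠ 0) (hρ0 : 0 ≤ ρ) (hρ : ρ < 1)
    (hp : p ∉ Set.diagonal (Cube n)) (ha : 0 ≤ a) :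
    killOp ρ ((Set.diagonal (Cube n)).indicator 1) p ≤ 2 * Real.exp (-a ^ 2 / (2 * sharedVar ρ)) +
      Real.exp (-(n * (2 * Real.exp (-3) / 9 * √(1 / n) * Real.exp (-a ^ 2)) / 4)) := by
  set e := Real.exp (-(n * (2 * Real.exp (-3) / 9 * √(1 / n) * Real.exp (-a ^ 2)) / 4)) with he
  rcases (disagree p.1 p.2)ᶜ.eq_empty_or_nonempty with hp' | hp'
  · rw [killOp_eq_zero hn ρ _ hp']
    positivity
  set B : Set ℝ := {t | a ≤ |t|}
  have hB : MeasurableSet B := measurableSet_le measurable_const (by fun_prop)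
  set E : Set (Fin n → ℝ) := (fun ν => wVec ρ ν p.1 p.2) ⁻¹' Set.univ ×ˢ B
  have hE : MeasurableSet E := measurable_wVec ρ p.1 p.2 (MeasurableSet.univ.prod hB)
  have hPE : (stdGaussianPi n).real E ≤ 2 * Real.exp (-a ^ 2 / (2 * sharedVar ρ)) := by
    rw [stdGaussianPi_real_wVec_mem ρ (disagree_nonempty_iff.2 hp) hp' .univ hB, probReal_univ,
      one_mul]
    exact gaussianReal_real_le_abs_le _ ha
  have hoff : ∀ ν ∉ E, ν ∈ aliveSet ρ p →
      ∫ ψ, (Set.diagonal (Cube n)).indicator 1 (stepPair ρ (ν, ψ) p) ∂privateLaw n ≤ e := by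
    intro ν hν _
    have hw : |(wVec ρ ν p.1 p.2).2| < a := lt_of_not_ge fun h => hν ⟨trivial, h⟩
    have hw2 : (wVec ρ ν p.1 p.2).2 ^ 2 ≤ a ^ 2 := sq_le_sq' (abs_lt.1 hw).1.le (abs_lt.1 hw).2.le
    have hfrac := inv_le_disagreeFrac hp
    have hflip : 2 * Real.exp (-3) / 9 * √(1 / n) * Real.exp (-a ^ 2) ≤ flipProb ρ ν p := by
      refine le_trans ?_ (exp_mul_sqrt_le_gProb _ (disagreeFrac_mem_unitInterval p.1 p.2))
      gcongr
    refine (integral_stepPair_indicator_diagonal_le hn hρ0 hρ ν p).trans ?_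
    rw [he]
    gcongr
  have hkill := killOp_le_of_forall_mem_of_forall_notMem hE zero_le_one (Real.exp_pos _).le
    (fun ν _ _ => integral_stepPair_le_one
      (Set.indicator_le_self' fun _ _ => zero_le_one) ρ ν p) hoff
  have hPE0 : 0 ≤ (stdGaussianPi n).real E * e := mul_nonneg measureReal_nonneg (Real.exp_pos _).le
  linarith

/-- The law of `W_t` gives this probability to the event that `|W₁|` is large and `|W₂| ≤ 1`. -/
def pushProb (R : NNReal) : ℝ :=
  (gaussianReal 0 R).real {r | pushConst + 2 ≤ |r|} * (gaussianReal 0 R).real {r | |r| ≤ 1}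

theorem pushProb_mem_unitInterval (R : NNReal) : pushProb R ∈ unitInterval :=
  unitInterval.mul_mem ⟨measureReal_nonneg, measureReal_le_one⟩
    ⟨measureReal_nonneg, measureReal_le_one⟩

/-- The shared vectors that push the disagreement up: `|W₁|` is large and `|W₂| ≤ 1`. -/
def pushSet (ρ : ℝ) (p : Cube n × Cube n) : Set (Fin n → ℝ) :=
  (fun ν => wVec ρ ν p.1 p.2) ⁻¹' {r | pushConst + 2 ≤ |r|} ×ˢ {r | |r| ≤ 1}

theorem killOp_le_of_pushSet (hn : n ≠ 0) (hp : p ∉ Set.diagonal (Cube n)) (hφ : φ ≤ 1)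
    (hc : c ∈ unitInterval) (h : ∀ ν ∈ pushSet ρ p, ν ∈ aliveSet ρ p →
      ∫ ψ, φ (stepPair ρ (ν, ψ) p) ∂privateLaw n ≤ 1 - c) :
    killOp ρ φ p ≤ 1 - pushProb (sharedVar ρ) * c := by
  rcases (disagree p.1 p.2)ᶜ.eq_empty_or_nonempty with hp' | hp'
  · rw [killOp_eq_zero hn ρ _ hp']
    exact (Set.Icc.one_sub_mem (unitInterval.mul_mem (pushProb_mem_unitInterval _) hc)).1
  have hlarge : MeasurableSet {r : ℝ | pushConst + 2 ≤ |r|} :=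
    measurableSet_le measurable_const (by fun_prop)
  have hsmall : MeasurableSet {r : ℝ | |r| ≤ 1} := measurableSet_le (by fun_prop) measurable_const
  have hprob : (stdGaussianPi n).real (pushSet ρ p) = pushProb (sharedVar ρ) :=
    stdGaussianPi_real_wVec_mem ρ (disagree_nonempty_iff.2 hp) hp' hlarge hsmall
  have hE : MeasurableSet (pushSet ρ p) := measurable_wVec ρ p.1 p.2 (hlarge.prod hsmall)
  have hkill := killOp_le_of_forall_mem_of_forall_notMem hE (sub_nonneg.2 hc.2) zero_le_one h
    fun ν _ _ => integral_stepPair_le_one hφ ρ ν p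
  rw [hprob] at hkill
  linarith

end OneStepBounds

/-! ### Reaching `g ≥ 1/2` -/

section Reaching

variable {n : ℕ} {ρ b : ℝ} {φ : Cube n × Cube n → ℝ} {p : Cube n × Cube n}

theorem notMem_diagonal_of_disagreeFrac_pos (h : 0 < disagreeFrac p.1 p.2) :
    p ∉ Set.diagonal (Cube n) := by
  intro hp
  simp [disagreeFrac, disagree, Set.mem_diagonal_iff.1 hp] at h

theorem one_le_mul_sqrt_disagreeFrac (hn : n ≠ 0) (hp : p ∉ Set.diagonal (Cube n)) :
    1 ≤ n * √(disagreeFrac p.1 p.2) := by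
  have : (0 : ℝ) < n := by positivity
  have hv := disagreeFrac_mem_unitInterval p.1 p.2
  calc (1 : ℝ) = n * (1 / n) := by field_simp
    _ ≤ n * disagreeFrac p.1 p.2 := by gcongr; exact inv_le_disagreeFrac hp
    _ ≤ n * √(disagreeFrac p.1 p.2) := by
        gcongr
        exact Real.le_sqrt_of_sq_le (pow_le_of_le_one hv.1 hv.2 two_ne_zero)

theorem privateLaw_real_disagreeFrac_stepPair_le_sqrt (hn : n ≠ 0) (hρ0 : 0 ≤ ρ) (hρ : ρ < 1)
    (hp : p ∉ Set.diagonal (Cube n)) {ν : Fin n → ℝ} (hpush : ν ∈ pushSet ρ p)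
    (halive : ν ∈ aliveSet ρ p) :
    (privateLaw n).real {ψ | disagreeFrac (stepPair ρ (ν, ψ) p).1 (stepPair ρ (ν, ψ) p).2 ≤
      √(disagreeFrac p.1 p.2)} ≤ 1 / 2 := by
  have hn' : (0 : ℝ) < n := by positivity
  have hg : 4 * √(disagreeFrac p.1 p.2) ≤ flipProb ρ ν p :=
    four_mul_sqrt_le_gProb (disagreeFrac_mem_unitInterval _ _).1 hpush.1 hpush.2 halive
  have hng : n * √(disagreeFrac p.1 p.2) ≤ n * flipProb ρ ν p / 4 := by
    linarith [mul_le_mul_of_nonneg_left hg hn'.le]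
  refine (measureReal_mono fun ψ hψ => ?_).trans
    ((privateLaw_real_card_disagree_le hn hρ0 hρ ν p).trans ?_)
  · rw [Set.mem_ofPred_eq, disagreeFrac, div_le_iff₀' hn'] at hψ
    exact hψ.trans hng
  · calc Real.exp (-(n * flipProb ρ ν p / 4)) ≤ Real.exp (-1) := by
          gcongr
          exact (one_le_mul_sqrt_disagreeFrac hn hp).trans hng
      _ ≤ 1 / 2 := by linarith [Real.exp_neg_one_lt_half]

theorem killOp_le_of_forall_sqrt_lt (hn : n ≠ 0) (hρ0 : 0 ≤ ρ) (hρ : ρ < 1)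
    (hp : p ∉ Set.diagonal (Cube n)) (hφ : φ ≤ 1) (hb : b ∈ unitInterval)
    (h : ∀ q : Cube n × Cube n, √(disagreeFrac p.1 p.2) < disagreeFrac q.1 q.2 → φ q ≤ 1 - b) :
    killOp ρ φ p ≤ 1 - pushProb (sharedVar ρ) / 2 * b := by
  have hb2 : b / 2 ∈ unitInterval := ⟨by linarith [hb.1], by linarith [hb.1, hb.2]⟩
  refine (killOp_le_of_pushSet hn hp hφ hb2 fun ν hpush halive => ?_).trans_eq (by ring)
  have hG : MeasurableSet {ψ | disagreeFrac (stepPair ρ (ν, ψ) p).1 (stepPair ρ (ν, ψ) p).2 ≤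
      √(disagreeFrac p.1 p.2)} := measurable_stepPair_right ρ ν p
    (t := {q | disagreeFrac q.1 q.2 ≤ √(disagreeFrac p.1 p.2)}) (Set.toFinite _).measurableSet
  have hint : Integrable (fun ψ => φ (stepPair ρ (ν, ψ) p)) (privateLaw n) :=
    (Integrable.of_finite (f := φ)).comp_measurable (measurable_stepPair_right ρ ν p)
  have hPG := privateLaw_real_disagreeFrac_stepPair_le_sqrt hn hρ0 hρ hp hpush halive
  have hmean := integral_le_of_forall_mem_of_forall_notMem (a := 1) (b := 1 - b) hG hint
    (fun ψ _ => hφ (stepPair ρ (ν, ψ) p)) fun ψ hψ => h (stepPair ρ (ν, ψ) p) (not_le.1 hψ)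
  linarith [mul_le_mul_of_nonneg_right hPG hb.1]

theorem survProb_one_le (hn : n ≠ 0) (ρ : ℝ) (hv : 1 / 4 ≤ disagreeFrac p.1 p.2) :
    survProb ρ 1 p ≤ 1 - pushProb (sharedVar ρ) := by
  have hp := notMem_diagonal_of_disagreeFrac_pos (p := p) (by linarith)
  have hsqrt : 1 / 2 ≤ √(disagreeFrac p.1 p.2) :=
    Real.le_sqrt_of_sq_le (by norm_num; linarith)
  rw [survProb_succ]
  refine (killOp_le_of_pushSet hn hp (survProb_le_one ρ 0) unitInterval.one_mem
    fun ν hpush halive => absurd halive (not_lt_of_ge (α := ℝ) ?_)).trans_eq (by ring)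
  exact half_le_gProb (disagreeFrac_mem_unitInterval _ _).1 hpush.1 hpush.2
    (by nlinarith [eight_le_pushConst])

theorem exp_neg_two_pow_le_sqrt {v : ℝ} {j : ℕ} (hv : Real.exp (-(2 : ℝ) ^ (j + 1)) ≤ v) :
    Real.exp (-(2 : ℝ) ^ j) ≤ √v := by
  refine Real.le_sqrt_of_sq_le (hv.trans_eq' ?_)
  rw [← Real.exp_nat_mul, pow_succ]
  congr 1
  push_cast
  ring

theorem survProb_succ_le_of_exp_neg_two_pow_le (hn : n ≠ 0) (hρ0 : 0 ≤ ρ) (hρ : ρ < 1) (j : ℕ)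
    (hv : Real.exp (-(2 : ℝ) ^ j) ≤ disagreeFrac p.1 p.2) :
    survProb ρ (j + 1) p ≤ 1 - (pushProb (sharedVar ρ) / 2) ^ (j + 1) := by
  have hq := pushProb_mem_unitInterval (sharedVar ρ)
  have hq2 : pushProb (sharedVar ρ) / 2 ∈ unitInterval :=
    ⟨by linarith [hq.1], by linarith [hq.1, hq.2]⟩
  induction j generalizing p with
  | zero =>
    have hquarter : 1 / 4 ≤ Real.exp (-1) := by linarith [Real.exp_neg_one_gt_d9]
    rw [pow_zero] at hv
    rw [zero_add, pow_one]
    linarith [survProb_one_le hn ρ (hquarter.trans hv), hq.1]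
  | succ j ih =>
    have hp := notMem_diagonal_of_disagreeFrac_pos ((Real.exp_pos _).trans_le hv)
    rw [survProb_succ, pow_succ']
    exact killOp_le_of_forall_sqrt_lt hn hρ0 hρ hp (survProb_le_one ρ (j + 1))
      ⟨pow_nonneg hq2.1 _, pow_le_one₀ hq2.1 hq2.2⟩
      fun q hpq => ih ((exp_neg_two_pow_le_sqrt hv).trans hpq.le)

end Reaching

/-! ### Asymptotics of the survival probability -/

section Blocks

variable {n : ℕ} {ρ L : ℝ} {p : Cube n × Cube n}

theorem coe_sharedVar (hρ0 : 0 ≤ ρ) (hρ : ρ < 1) : (sharedVar ρ : ℝ) = ρ / (1 - ρ) :=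
  Real.coe_toNNReal _ (div_nonneg hρ0 (sub_nonneg.2 hρ.le))

theorem exists_pos_forall_div_sqrt_le_pushProb {δ : ℝ} (hδ : 0 < δ) :
    ∃ c > 0, ∀ R : NNReal, δ ≤ R → c / √R ≤ pushProb R := by
  have hpush := eight_le_pushConst
  refine ⟨Real.exp (-(((pushConst + 2) / √δ + 1) ^ 2 / 2)) / 3 *
    (2 * Real.exp (-(1 / (2 * δ))) / 3), by positivity, fun R hδR => ?_⟩
  have hR : (0 : ℝ) < R := hδ.trans_le hδR
  have hR0 : R ≠ 0 := (NNReal.coe_pos.1 hR).ne'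
  have hexp : ((pushConst + 2 + √R) ^ 2 / (2 * R) : ℝ) = ((pushConst + 2) / √R + 1) ^ 2 / 2 := by
    rw [div_add_one (Real.sqrt_ne_zero'.2 hR), div_pow, Real.sq_sqrt hR.le, div_div, mul_comm]
  have hlarge : Real.exp (-(((pushConst + 2) / √δ + 1) ^ 2 / 2)) / 3 ≤
      (gaussianReal 0 R).real {r | pushConst + 2 ≤ |r|} := by
    refine le_trans ?_ (exp_le_gaussianReal_real_le_abs hR0 0 (by positivity))
    rw [hexp]
    gcongr
  have hsmall : 2 * Real.exp (-(1 / (2 * δ))) / 3 / √R ≤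
      (gaussianReal 0 R).real {r | |r| ≤ 1} := by
    refine le_trans ?_ (two_mul_exp_le_gaussianReal_real_abs_le (B := 1) hR0 zero_le_one (by simp))
    rw [one_pow, mul_one, div_div, ← mul_div_assoc]
    gcongr
  rw [mul_div_assoc]
  exact mul_le_mul hlarge hsmall (by positivity) measureReal_nonneg

theorem exists_exp_le_two_pow (hL : 8 ≤ L) :
    ∃ k : ℕ, Real.exp L ≤ 2 ^ k ∧ ((k + 1 : ℕ) : ℝ) ≤ 2 * L := by
  obtain ⟨k, hk, hk'⟩ := exists_nat_pow_near
    (Real.one_le_exp (show 0 ≤ L by linarith)) (one_lt_two : (1 : ℝ) < 2)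
  have hlog : (k : ℝ) * Real.log 2 ≤ L := by
    rw [← Real.log_pow]
    exact (Real.log_le_iff_le_exp (by positivity)).2 hk
  refine ⟨k + 1, hk'.le, ?_⟩
  push_cast
  nlinarith [Real.log_two_gt_d9, (Nat.cast_nonneg k : (0 : ℝ) ≤ k)]

theorem survProb_succ_le_one_sub_exp (hn : (n : ℝ) = Real.exp (Real.exp L)) (hL : 0 ≤ L)
    (hρ0 : 0 ≤ ρ) (hρ : ρ < 1) (hq : Real.exp (-L) ≤ pushProb (sharedVar ρ) / 2) {k : ℕ}
    (hk : Real.exp L ≤ 2 ^ k) (hkL : ((k + 1 : ℕ) : ℝ) ≤ 2 * L) (hp : p ∉ Set.diagonal (Cube n)) :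
    survProb ρ (k + 1) p ≤ 1 - Real.exp (-(2 * L ^ 2)) := by
  have hn0 : n ≠ 0 := Nat.cast_ne_zero.1 (hn ▸ (Real.exp_pos _).ne')
  have hfrac : Real.exp (-(2 : ℝ) ^ k) ≤ disagreeFrac p.1 p.2 := by
    refine le_trans ?_ (inv_le_disagreeFrac hp)
    rw [hn, one_div, ← Real.exp_neg]
    gcongr
  have hb : Real.exp (-(2 * L ^ 2)) ≤ (pushProb (sharedVar ρ) / 2) ^ (k + 1) :=
    calc Real.exp (-(2 * L ^ 2)) ≤ Real.exp (-L) ^ (k + 1) := by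
          rw [← Real.exp_nat_mul, Real.exp_le_exp]
          linarith [mul_le_mul_of_nonneg_right hkL hL]
      _ ≤ (pushProb (sharedVar ρ) / 2) ^ (k + 1) := by gcongr
  linarith [survProb_succ_le_of_exp_neg_two_pow_le hn0 hρ0 hρ k hfrac]

theorem killOp_indicator_diagonal_le_exp (hn : (n : ℝ) = Real.exp (Real.exp L)) (hL : 0 ≤ L)
    (hρ0 : 0 < ρ) (hρ : ρ < 1) (hR : sharedVar ρ * L ^ 3 ≤ Real.exp L / 4)
    (hlarge : L ^ 3 / 2 ≤ 2 * Real.exp (-3) / 9 / 4 * Real.exp (Real.exp L / 4))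
    (hp : p ∉ Set.diagonal (Cube n)) :
    killOp ρ ((Set.diagonal (Cube n)).indicator 1) p ≤ 3 * Real.exp (-(L ^ 3 / 2)) := by
  have hn0 : n ≠ 0 := Nat.cast_ne_zero.1 (hn ▸ (Real.exp_pos _).ne')
  have hR0 : (0 : ℝ) < sharedVar ρ := by
    rw [coe_sharedVar hρ0.le hρ]
    exact div_pos hρ0 (sub_pos.2 hρ)
  have hsqrt : √(1 / (n : ℝ)) = Real.exp (-Real.exp L / 2) := by
    rw [hn, one_div, ← Real.exp_neg, Real.exp_half]
  have hfew : Real.exp (Real.exp L / 4) ≤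
      n * √(1 / (n : ℝ)) * Real.exp (-(sharedVar ρ * L ^ 3)) := by
    rw [hsqrt, hn, ← Real.exp_add, ← Real.exp_add, Real.exp_le_exp]
    linarith
  have hmerge := killOp_indicator_diagonal_le hn0 hρ0.le hρ hp
    (Real.sqrt_nonneg (sharedVar ρ * L ^ 3))
  rw [neg_eq_neg_one_mul (√_ ^ 2), Real.sq_sqrt (by positivity), ← neg_eq_neg_one_mul] at hmerge
  have htail : -(sharedVar ρ * L ^ 3) / (2 * sharedVar ρ) = -(L ^ 3 / 2) := by
    field_simp
  have hbinom : Real.exp (-(n * (2 * Real.exp (-3) / 9 * √(1 / n) *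
      Real.exp (-(sharedVar ρ * L ^ 3))) / 4)) ≤ Real.exp (-(L ^ 3 / 2)) := by
    rw [Real.exp_le_exp, neg_le_neg_iff]
    refine hlarge.trans ((mul_le_mul_of_nonneg_left hfew (by positivity)).trans_eq (by ring))
  rw [htail] at hmerge
  linarith

theorem one_sub_exp_pow_le {T K : ℕ} (hL : 1 ≤ L) (hK : K ≠ 0) (hKL : (K : ℝ) ≤ 2 * L)
    (hT : Real.exp (4 * L ^ 2) ≤ T) :
    (1 - Real.exp (-(2 * L ^ 2))) ^ ((T - 1) / K) ≤ Real.exp (1 - L) := by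
  set b := Real.exp (-(2 * L ^ 2)) with hb
  set j := (T - 1) / K with hj
  have hb1 : b ≤ 1 := Real.exp_le_one_iff.2 (by nlinarith)
  have hTj : (T : ℝ) ≤ 2 * L * (j + 1) := by
    have hdiv := Nat.lt_mul_div_succ (T - 1) (Nat.pos_of_ne_zero hK)
    rw [← hj] at hdiv
    have hTK : T ≤ K * (j + 1) := by omega
    exact (Nat.cast_le (α := ℝ).2 hTK).trans (by push_cast; gcongr)
  have hbj : L - 1 ≤ b * j := by
    have hprod : b * Real.exp (4 * L ^ 2) = Real.exp (2 * L ^ 2) := by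
      rw [hb, ← Real.exp_add]
      ring_nf
    have hmul : 2 * L * L ≤ 2 * L * (b * j + b) :=
      calc 2 * L * L ≤ 2 * L ^ 2 + 1 := by linarith
        _ ≤ Real.exp (2 * L ^ 2) := Real.add_one_le_exp _
        _ = b * Real.exp (4 * L ^ 2) := hprod.symm
        _ ≤ b * (2 * L * (j + 1)) := by gcongr; exact hT.trans hTj
        _ = 2 * L * (b * j + b) := by ring
    linarith [le_of_mul_le_mul_left hmul (by linarith)]
  calc (1 - b) ^ j ≤ Real.exp (-b) ^ j := by
        gcongr
        exact Real.one_sub_le_exp_neg b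
    _ = Real.exp (-(b * j)) := by
        rw [← Real.exp_nat_mul]
        ring_nf
    _ ≤ Real.exp (1 - L) := by
        gcongr
        linarith

/-- The bound on the survival probability, as a function of `L = log log n`. -/
def survBound (L : ℝ) : ℝ := Real.exp (1 - L) + 6 * (L * Real.exp (-L))

theorem survProb_le_survBound (hn : (n : ℝ) = Real.exp (Real.exp L)) (hL : 8 ≤ L) (hρ0 : 0 < ρ)
    (hρ : ρ < 1) (hR : sharedVar ρ * L ^ 3 ≤ Real.exp L / 4)
    (hq : Real.exp (-L) ≤ pushProb (sharedVar ρ) / 2)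
    (hlarge : L ^ 3 / 2 ≤ 2 * Real.exp (-3) / 9 / 4 * Real.exp (Real.exp L / 4)) {T : ℕ}
    (hT : Real.exp (4 * L ^ 2) ≤ T) (hp : p ∉ Set.diagonal (Cube n)) :
    survProb ρ (T - 1) p ≤ survBound L := by
  have hL0 : 0 ≤ L := by linarith
  obtain ⟨k, hk, hkL⟩ := exists_exp_le_two_pow hL
  have hblocks := (isSubMarkov_killOp n ρ).pow_mul_one_le (η := 3 * Real.exp (-(L ^ 3 / 2)))
    (by positivity) (Real.exp_pos (-(2 * L ^ 2)))
    (Real.exp_le_one_iff.2 (by nlinarith)) (k + 1)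
    (fun q hq => killOp_indicator_diagonal_le_exp hn hL0 hρ0 hρ hR hlarge hq)
    (fun q hqD => survProb_succ_le_one_sub_exp hn hL0 hρ0.le hρ hq hk hkL hqD)
    ((T - 1) / (k + 1)) hp
  have hratio : Real.exp (-(L ^ 3 / 2)) / Real.exp (-(2 * L ^ 2)) ≤ Real.exp (-L) := by
    rw [← Real.exp_sub, Real.exp_le_exp]
    nlinarith [mul_nonneg (sq_nonneg L) (sub_nonneg.2 hL)]
  calc survProb ρ (T - 1) p ≤ survProb ρ ((k + 1) * ((T - 1) / (k + 1))) p :=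
        antitone_survProb ρ p (Nat.mul_div_le _ _)
    _ ≤ _ := hblocks
    _ = (1 - Real.exp (-(2 * L ^ 2))) ^ ((T - 1) / (k + 1)) + ((k + 1 : ℕ) : ℝ) * 3 *
        (Real.exp (-(L ^ 3 / 2)) / Real.exp (-(2 * L ^ 2))) := by ring
    _ ≤ Real.exp (1 - L) + 2 * L * 3 * Real.exp (-L) := by
        gcongr
        exact one_sub_exp_pow_le (by linarith) k.succ_ne_zero hkL hT
    _ = survBound L := by
        rw [survBound]
        ring

end Blocks

section Limits

theorem tendsto_survBound : Tendsto survBound atTop (𝓝 0) := by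
  have hexp : Tendsto (fun L : ℝ => Real.exp (1 - L)) atTop (𝓝 0) :=
    Real.tendsto_exp_atBot.comp (tendsto_const_nhds.add_atBot tendsto_neg_atTop_atBot)
  have hmul := (Real.tendsto_pow_mul_exp_neg_atTop_nhds_zero 1).const_mul 6
  simp only [pow_one, mul_zero] at hmul
  have hadd := hexp.add hmul
  rwa [add_zero] at hadd

theorem survBound_nonneg {L : ℝ} (hL : 0 ≤ L) : 0 ≤ survBound L := by
  unfold survBound
  positivity

theorem tendsto_log_log_natCast_atTop :
    Tendsto (fun n : ℕ => Real.log (Real.log n)) atTop atTop :=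
  Real.tendsto_log_atTop.comp (Real.tendsto_log_atTop.comp tendsto_natCast_atTop_atTop)

theorem eventually_cube_le_mul_exp_exp {c : ℝ} (hc : 0 < c) :
    ∀ᶠ L : ℝ in atTop, L ^ 3 / 2 ≤ c * Real.exp (Real.exp L / 4) := by
  filter_upwards [(Real.tendsto_pow_mul_exp_neg_atTop_nhds_zero 3).eventually_le_const hc,
    eventually_ge_atTop (8 : ℝ)] with L hcube hL
  have hexp : L ≤ Real.exp L / 4 := by
    nlinarith [Real.quadratic_le_exp_of_nonneg (show 0 ≤ L by linarith)]
  rw [Real.exp_neg L, ← div_eq_mul_inv, div_le_iff₀ (Real.exp_pos _)] at hcube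
  calc L ^ 3 / 2 ≤ L ^ 3 := half_le_self (by positivity)
    _ ≤ c * Real.exp L := hcube
    _ ≤ c * Real.exp (Real.exp L / 4) := by gcongr

theorem eventually_exp_neg_le_mul_exp_neg_half {c : ℝ} (hc : 0 < c) :
    ∀ᶠ L : ℝ in atTop, Real.exp (-L) ≤ c / √(Real.exp L) := by
  filter_upwards [eventually_ge_atTop (2 * -Real.log c)] with L hL
  rw [← Real.exp_half, ← Real.exp_log hc, ← Real.exp_sub, Real.exp_le_exp]
  linarith

theorem lt_one_of_lt_one_sub_cube_div {ρ L ℓ : ℝ} (hL : 0 ≤ L) (hℓ : 0 ≤ ℓ)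
    (hρ : ρ < 1 - 4 * L ^ 3 / ℓ) : ρ < 1 :=
  hρ.trans_le (sub_le_self 1 (by positivity))

theorem sharedVar_mul_cube_le {ρ L : ℝ} (hL : 0 ≤ L) (hρ0 : 0 ≤ ρ)
    (hρ : ρ < 1 - 4 * L ^ 3 / Real.exp L) : sharedVar ρ * L ^ 3 ≤ Real.exp L / 4 := by
  have hρ1 := lt_one_of_lt_one_sub_cube_div hL (Real.exp_pos L).le hρ
  have hL3 : 0 ≤ L ^ 3 := by positivity
  rw [lt_sub_comm, div_lt_iff₀ (Real.exp_pos L)] at hρ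
  rw [coe_sharedVar hρ0 hρ1, div_mul_eq_mul_div, div_le_iff₀ (sub_pos.2 hρ1)]
  nlinarith

theorem eventually_survProb_le_survBound {δ : ℝ} {ρ : ℕ → ℝ} {T : ℕ → ℕ} (hδ : 0 < δ)
    (hρ : ∀ᶠ n : ℕ in atTop, δ < ρ n ∧
      ρ n < 1 - 4 * Real.log (Real.log n) ^ 3 / Real.log n)
    (hT : ∀ᶠ n : ℕ in atTop, Real.exp (4 * Real.log (Real.log n) ^ 2) ≤ (T n : ℝ)) :
    ∀ᶠ n : ℕ in atTop, ∀ p ∉ Set.diagonal (Cube n),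
      survProb (ρ n) (T n - 1) p ≤ survBound (Real.log (Real.log n)) := by
  obtain ⟨c, hc, hpush⟩ := exists_pos_forall_div_sqrt_le_pushProb hδ
  filter_upwards [hρ, hT, tendsto_log_log_natCast_atTop.eventually_ge_atTop 8,
    tendsto_log_log_natCast_atTop.eventually (eventually_exp_neg_le_mul_exp_neg_half (half_pos hc)),
    tendsto_log_log_natCast_atTop.eventually (eventually_cube_le_mul_exp_exp
      (c := 2 * Real.exp (-3) / 9 / 4) (by positivity)),
    (Real.tendsto_log_atTop.comp tendsto_natCast_atTop_atTop).eventually_gt_atTop 0,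
    eventually_gt_atTop 0] with n hρn hTn hL hcL hcube hlog hn p hp
  have hexp : Real.exp (Real.log (Real.log n)) = Real.log n := Real.exp_log hlog
  set L := Real.log (Real.log n)
  rw [← hexp] at hρn
  have hn' : (n : ℝ) = Real.exp (Real.exp L) := by
    rw [hexp, Real.exp_log (Nat.cast_pos.2 hn)]
  have hL0 : 0 ≤ L := by linarith
  have hρ0 : 0 < ρ n := hδ.trans hρn.1
  have hρ1 := lt_one_of_lt_one_sub_cube_div hL0 (Real.exp_pos L).le hρn.2
  have hR := sharedVar_mul_cube_le hL0 hρ0.le hρn.2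
  have hδR : δ ≤ sharedVar (ρ n) := by
    rw [coe_sharedVar hρ0.le hρ1, le_div_iff₀ (sub_pos.2 hρ1)]
    nlinarith
  have hRL : (sharedVar (ρ n) : ℝ) ≤ Real.exp L := by
    nlinarith [one_le_pow₀ (show 1 ≤ L by linarith) (n := 3), NNReal.coe_nonneg (sharedVar (ρ n)),
      Real.exp_pos L]
  refine survProb_le_survBound hn' hL hρ0 hρ1 hR ?_ hcube hTn hp
  have hR0 : (0 : ℝ) < sharedVar (ρ n) := hδ.trans_le hδR
  calc Real.exp (-L) ≤ c / 2 / √(Real.exp L) := hcL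
    _ ≤ c / 2 / √(sharedVar (ρ n)) := by gcongr
    _ = c / √(sharedVar (ρ n)) / 2 := by ring
    _ ≤ pushProb (sharedVar (ρ n)) / 2 := by gcongr; exact hpush _ hδR

end Limits

/-! ### Quantitative noise sensitivity of random odd functions -/

section RandomOdd

variable {n : ℕ} {ε : ℝ} {π : Measure (BoolFun n)}

/-- The noise stability of a random Boolean function with law `π`, averaged over `π`. -/
def meanNoiseStab (ε : ℝ) (π : Measure (BoolFun n)) : ℝ :=
  ∫ f, noiseStab ε (fun x => signVal (f x)) ∂π

theorem odd_signVal_comp {f : BoolFun n} (hf : f.Odd) :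
    Function.Odd fun x => signVal (f x) := fun x => by
  simp only [hf x, signVal_neg]

theorem annealed_covariance_eq_meanNoiseStab [IsProbabilityMeasure π] (hε : ε ∈ unitInterval)
    (hπ : ∀ᵐ f ∂π, f.Odd) :
    cov[fun x => signVal (x.1 x.2.1), fun x => signVal (x.1 x.2.2); π.prod (noisyPair n ε)] =
      meanNoiseStab ε π := by
  have := isProbabilityMeasure_noisyPair n hε
  have hmean : ∫ x : BoolFun n × (Cube n × Cube n), signVal (x.1 x.2.1)
      ∂π.prod (noisyPair n ε) = 0 := by
    rw [integral_prod _ .of_finite]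
    exact integral_eq_zero_of_ae (hπ.mono fun f hf =>
      integral_fst_noisyPair_of_odd hε (odd_signVal_comp hf))
  rw [covariance_eq_sub .of_discrete .of_discrete, hmean, zero_mul, sub_zero,
    integral_prod _ .of_finite]
  rfl

theorem one_sub_div_le_real_covariance_le [IsProbabilityMeasure π] (h0 : 0 ≤ ε) (h1 : ε ≤ 1 / 2)
    (hπ : ∀ᵐ f ∂π, f.Odd) {a : ℝ} (ha : 0 < a) :
    1 - meanNoiseStab ε π / a ≤
      π.real {f | cov[fun x => signVal (f x.1), fun x => signVal (f x.2); noisyPair n ε] ≤ a} := by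
  have hmarkov : π.real {f | a ≤ noiseStab ε fun x => signVal (f x)} ≤ meanNoiseStab ε π / a := by
    rw [le_div_iff₀' ha]
    exact mul_meas_ge_le_integral_of_nonneg (ae_of_all _ fun f => noiseStab_nonneg h0 h1 _)
      .of_finite a
  have hcompl : 1 - π.real {f | a ≤ noiseStab ε fun x => signVal (f x)} ≤
      π.real {f | noiseStab ε (fun x => signVal (f x)) ≤ a} := by
    rw [← probReal_compl_eq_one_sub (Set.toFinite _).measurableSet]
    exact measureReal_mono fun f hf => (lt_of_not_ge (α := ℝ) hf).le
  have hcov : ∀ᵐ f ∂π,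
      cov[fun x => signVal (f x.1), fun x => signVal (f x.2); noisyPair n ε] ≤ a ↔
        noiseStab ε (fun x => signVal (f x)) ≤ a :=
    hπ.mono fun f hf => by
      rw [← noiseStab_eq_covariance_of_odd ⟨h0, by linarith⟩ (odd_signVal_comp hf)]
  calc 1 - meanNoiseStab ε π / a
      ≤ 1 - π.real {f | a ≤ noiseStab ε fun x => signVal (f x)} := sub_le_sub_left hmarkov 1
    _ ≤ π.real {f | noiseStab ε (fun x => signVal (f x)) ≤ a} := hcompl
    _ = _ := measureReal_congr (eventuallyEq_set.2 (hcov.mono fun f hf => hf.symm))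

end RandomOdd

section QNS

variable {π : (n : ℕ) → Measure (BoolFun n)} [∀ n, IsProbabilityMeasure (π n)] {ε : ℕ → ℝ}

theorem annealedQNS_of_tendsto_meanNoiseStab (hε : ∀ᶠ n in atTop, ε n ∈ unitInterval)
    (hπ : ∀ᶠ n in atTop, ∀ᵐ f ∂π n, f.Odd)
    (hlim : Tendsto (fun n => meanNoiseStab (ε n) (π n)) atTop (𝓝 0)) : AnnealedQNS π ε := by
  refine hlim.congr' ?_
  filter_upwards [hε, hπ] with n hεn hπn
  exact (annealed_covariance_eq_meanNoiseStab hεn hπn).symm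

theorem quenchedQNS_of_tendsto_meanNoiseStab
    (hε : ∀ᶠ n in atTop, ε n ∈ Set.Icc 0 (1 / 2)) (hπ : ∀ᶠ n in atTop, ∀ᵐ f ∂π n, f.Odd)
    (hlim : Tendsto (fun n => meanNoiseStab (ε n) (π n)) atTop (𝓝 0)) : QuenchedQNS π ε := by
  intro δ hδ
  rw [← eventually_atTop]
  filter_upwards [hε, hπ, hlim.eventually_le_const (mul_pos hδ hδ)] with n hεn hπn hstab
  refine le_trans ?_ (one_sub_div_le_real_covariance_le hεn.1 hεn.2 hπn hδ)
  gcongr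
  exact (div_le_iff₀ hδ).2 hstab

end QNS

/-! ### Noise stability of the network -/

section Network

variable {n T : ℕ} {ρ ε a : ℝ} {h : BoolFun n}

theorem isProbabilityMeasure_networkFunLaw (n : ℕ) (ρ : ℝ) (T : ℕ) (h : BoolFun n) :
    IsProbabilityMeasure (networkFunLaw n ρ T h) :=
  Measure.isProbabilityMeasure_map (measurable_network ρ T h).aemeasurable

theorem ae_networkFunLaw_odd (hρ : ρ < 1) (T : ℕ) (hh : h.Odd) :
    ∀ᵐ f ∂networkFunLaw n ρ T h, f.Odd :=
  (ae_map_iff (measurable_network ρ T h).aemeasurable (Set.toFinite _).measurableSet).2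
    (ae_network_odd hρ T hh)

theorem meanNoiseStab_networkFunLaw (hε : ε ∈ unitInterval) (ρ : ℝ) (T : ℕ) (h : BoolFun n) :
    meanNoiseStab ε (networkFunLaw n ρ T h) = ∫ p, outputCorr ρ h T p ∂noisyPair n ε := by
  rw [meanNoiseStab, networkFunLaw, integral_map (measurable_network ρ T h).aemeasurable
    (measurable_of_countable _).aestronglyMeasurable, integral_outputCorr_noisyPair hε]

theorem meanNoiseStab_networkFunLaw_succ_le (hn : n ≠ 0) (hε : ε ∈ unitInterval) (hρ0 : 0 ≤ ρ)
    (hρ : ρ < 1) (hh : h.Odd) (m : ℕ) :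
    meanNoiseStab ε (networkFunLaw n ρ (m + 1) h) ≤ ∫ p, survProb ρ m p ∂noisyPair n ε := by
  have := isProbabilityMeasure_noisyPair n hε
  rw [meanNoiseStab_networkFunLaw hε]
  exact integral_mono .of_finite .of_finite (outputCorr_succ_le_survProb hn hρ0 hρ hh m)

theorem mem_noHit_of_lt_hitTime {Θ : ℕ → Layer n} {p : Cube n × Cube n}
    (h : (T : ℕ∞) < hitTime ρ (1 / 2) Θ p.1 p.2) : Θ ∈ noHit ρ T p := by
  refine fun s hs => lt_of_not_ge (α := ℝ) fun hg => h.not_ge ?_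
  exact (iInf₂_le s hg).trans (Nat.cast_le.2 hs)

theorem prod_lt_hitTime_le (hε : ε ∈ unitInterval) (ρ : ℝ) {m : ℕ} (hm : m ≤ T) :
    ((networkLaw n).prod (noisyPair n ε)) {x | (T : ℕ∞) < hitTime ρ (1 / 2) x.1 x.2.1 x.2.2} ≤
      ENNReal.ofReal (∫ p, survProb ρ m p ∂noisyPair n ε) := by
  have := isProbabilityMeasure_noisyPair n hε
  have hsub : {x : (ℕ → Layer n) × (Cube n × Cube n) |
      (T : ℕ∞) < hitTime ρ (1 / 2) x.1 x.2.1 x.2.2} ⊆ {q | q.1 ∈ noHit ρ m q.2} :=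
    fun q hq => mem_noHit_of_lt_hitTime (hq.trans_le' (Nat.cast_le.2 hm))
  have hmeas : MeasurableSet {q : (ℕ → Layer n) × (Cube n × Cube n) | q.1 ∈ noHit ρ m q.2} :=
    measurableSet_setOfPred.2
      (measurable_from_prod_countable_left fun p => (measurableSet_noHit ρ m p).mem)
  refine (measure_mono hsub).trans ?_
  rw [Measure.prod_apply_symm hmeas, ofReal_integral_eq_lintegral_ofReal .of_finite
    (ae_of_all _ fun p => networkLaw_real_noHit ρ m p ▸ measureReal_nonneg)]
  refine lintegral_mono fun p => le_of_eq ?_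
  rw [← networkLaw_real_noHit ρ m p, ofReal_measureReal]
  rfl

theorem integral_survProb_le {m : ℕ} (hε : ε ∈ unitInterval) (ha0 : 0 ≤ a)
    (ha : ∀ p ∉ Set.diagonal (Cube n), survProb ρ m p ≤ a) :
    ∫ p, survProb ρ m p ∂noisyPair n ε ≤ (1 - ε) ^ n + a := by
  have := isProbabilityMeasure_noisyPair n hε
  calc ∫ p, survProb ρ m p ∂noisyPair n ε
      ≤ (noisyPair n ε).real (Set.diagonal (Cube n)) * 1 +
          (1 - (noisyPair n ε).real (Set.diagonal (Cube n))) * a :=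
        integral_le_of_forall_mem_of_forall_notMem (Set.toFinite _).measurableSet .of_finite
          (fun p _ => survProb_le_one ρ m p) ha
    _ ≤ (1 - ε) ^ n + a := by
        rw [← noisyPair_real_diagonal hε, mul_one]
        refine add_le_add le_rfl (mul_le_of_le_one_left ha0 (sub_le_self 1 measureReal_nonneg))

end Network

/-! ### The limit -/

section Limit

variable {δ : ℝ} {ε ρ : ℕ → ℝ} {T : ℕ → ℕ}

theorem tendsto_one_sub_pow_of_tendsto_mul_atTop (hε : ∀ᶠ n in atTop, ε n ≤ 1)
    (hnε : Tendsto (fun n : ℕ => (n : ℝ) * ε n) atTop atTop) :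
    Tendsto (fun n => (1 - ε n) ^ n) atTop (𝓝 0) := by
  refine squeeze_zero' (hε.mono fun n hn => pow_nonneg (sub_nonneg.2 hn) n)
    (hε.mono fun n hn => ?_) (Real.tendsto_exp_neg_atTop_nhds_zero.comp hnε)
  calc (1 - ε n) ^ n ≤ Real.exp (-ε n) ^ n := by
        exact pow_le_pow_left₀ (sub_nonneg.2 hn) (Real.one_sub_le_exp_neg _) n
    _ = Real.exp (-(n * ε n)) := by rw [← Real.exp_nat_mul, mul_neg]

theorem eventually_mem_Icc_of_tendsto_mul_atTop (hε : ∀ᶠ n in atTop, ε n ≤ 1 / 2)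
    (hnε : Tendsto (fun n : ℕ => (n : ℝ) * ε n) atTop atTop) :
    ∀ᶠ n in atTop, ε n ∈ Set.Icc 0 (1 / 2) := by
  filter_upwards [hε, hnε.eventually_gt_atTop 0] with n hn hpos
  exact ⟨(pos_of_mul_pos_right hpos n.cast_nonneg).le, hn⟩

theorem tendsto_integral_survProb (hδ : 0 < δ) (hε : ∀ᶠ n in atTop, ε n ∈ Set.Icc 0 (1 / 2))
    (hnε : Tendsto (fun n : ℕ => (n : ℝ) * ε n) atTop atTop)
    (hρ : ∀ᶠ n : ℕ in atTop, δ < ρ n ∧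
      ρ n < 1 - 4 * Real.log (Real.log n) ^ 3 / Real.log n)
    (hT : ∀ᶠ n : ℕ in atTop, Real.exp (4 * Real.log (Real.log n) ^ 2) ≤ (T n : ℝ)) :
    Tendsto (fun n => ∫ p, survProb (ρ n) (T n - 1) p ∂noisyPair n (ε n)) atTop (𝓝 0) := by
  have hε1 : ∀ᶠ n in atTop, ε n ≤ 1 := hε.mono fun n hn => hn.2.trans (by norm_num)
  have hbound := (tendsto_one_sub_pow_of_tendsto_mul_atTop hε1 hnε).add
    (tendsto_survBound.comp tendsto_log_log_natCast_atTop)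
  rw [add_zero] at hbound
  refine squeeze_zero' (.of_forall fun n => integral_nonneg fun p =>
    networkLaw_real_noHit (ρ n) (T n - 1) p ▸ measureReal_nonneg) ?_ hbound
  filter_upwards [hε, hε1, eventually_survProb_le_survBound hδ hρ hT,
    tendsto_log_log_natCast_atTop.eventually_ge_atTop 0] with n hεn hεn1 hsurv hL
  exact integral_survProb_le ⟨hεn.1, hεn1⟩ (survBound_nonneg hL) hsurv

theorem eventually_lt_one_of_lt_one_sub_cube
    (hρ : ∀ᶠ n : ℕ in atTop, ρ n < 1 - 4 * Real.log (Real.log n) ^ 3 / Real.log n) :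
    ∀ᶠ n in atTop, ρ n < 1 := by
  filter_upwards [hρ, tendsto_log_log_natCast_atTop.eventually_ge_atTop 0] with n hn hL
  exact lt_one_of_lt_one_sub_cube_div hL (Real.log_natCast_nonneg n) hn

theorem tendsto_prod_lt_hitTime (hε : ∀ᶠ n in atTop, ε n ∈ unitInterval)
    (hsurv : Tendsto (fun n => ∫ p, survProb (ρ n) (T n - 1) p ∂noisyPair n (ε n)) atTop (𝓝 0)) :
    Tendsto (fun n => ((networkLaw n).prod (noisyPair n (ε n)))
      {x | (T n : ℕ∞) < hitTime (ρ n) (1 / 2) x.1 x.2.1 x.2.2}) atTop (𝓝 0) := by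
  have hlim := ENNReal.tendsto_ofReal hsurv
  rw [ENNReal.ofReal_zero] at hlim
  exact tendsto_of_tendsto_of_tendsto_of_le_of_le' tendsto_const_nhds hlim
    (.of_forall fun _ => zero_le)
    (hε.mono fun n hεn => prod_lt_hitTime_le hεn (ρ n) (Nat.sub_le _ _))

theorem tendsto_meanNoiseStab_networkFunLaw {h : (n : ℕ) → BoolFun n}
    (hε : ∀ᶠ n in atTop, ε n ∈ Set.Icc 0 (1 / 2)) (hρ : ∀ᶠ n in atTop, ρ n ∈ Set.Ico 0 1)
    (hT : ∀ᶠ n in atTop, 0 < T n) (hh : ∀ᶠ n in atTop, (h n).Odd)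
    (hsurv : Tendsto (fun n => ∫ p, survProb (ρ n) (T n - 1) p ∂noisyPair n (ε n)) atTop (𝓝 0)) :
    Tendsto (fun n => meanNoiseStab (ε n) (networkFunLaw n (ρ n) (T n) (h n))) atTop (𝓝 0) := by
  refine squeeze_zero' (hε.mono fun n hεn => integral_nonneg fun f =>
    noiseStab_nonneg hεn.1 hεn.2 _) ?_ hsurv
  filter_upwards [hε, hρ, hT, hh, eventually_ne_atTop 0] with n hεn hρn hTn hhn hn
  have hstab := meanNoiseStab_networkFunLaw_succ_le hn ⟨hεn.1, hεn.2.trans (by norm_num)⟩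
    hρn.1 hρn.2 hhn (T n - 1)
  rwa [Nat.sub_add_cancel hTn] at hstab

theorem mainTheorem4_general (hδ : 0 < δ) (hε : ∀ᶠ n in atTop, ε n ≤ 1 / 2)
    (hnε : Tendsto (fun n : ℕ => (n : ℝ) * ε n) atTop atTop)
    (hρ : ∀ᶠ n : ℕ in atTop, δ < ρ n ∧
      ρ n < 1 - 4 * Real.log (Real.log n) ^ 3 / Real.log n)
    (hT : ∀ᶠ n : ℕ in atTop, Real.exp (4 * Real.log (Real.log n) ^ 2) ≤ (T n : ℝ)) :
    Tendsto (fun n => ((networkLaw n).prod (noisyPair n (ε n)))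
        {x | (T n : ℕ∞) < hitTime (ρ n) (1 / 2) x.1 x.2.1 x.2.2}) atTop (𝓝 0) ∧
      ∀ h : (n : ℕ) → BoolFun n, (∀ᶠ n : ℕ in atTop, Function.Odd (h n)) →
        AnnealedQNS (fun n => networkFunLaw n (ρ n) (T n) (h n)) ε ∧
        QuenchedQNS (fun n => networkFunLaw n (ρ n) (T n) (h n)) ε := by
  have hεI := eventually_mem_Icc_of_tendsto_mul_atTop hε hnε
  have hε1 : ∀ᶠ n in atTop, ε n ∈ unitInterval :=
    hεI.mono fun n hn => ⟨hn.1, hn.2.trans (by norm_num)⟩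
  have hsurv := tendsto_integral_survProb hδ hεI hnε hρ hT
  have hρI : ∀ᶠ n in atTop, ρ n ∈ Set.Ico 0 1 := by
    filter_upwards [hρ, eventually_lt_one_of_lt_one_sub_cube (hρ.mono fun n hn => hn.2)]
      with n hn hn1 using ⟨(hδ.trans hn.1).le, hn1⟩
  have hTpos : ∀ᶠ n in atTop, 0 < T n :=
    hT.mono fun n hn => Nat.cast_pos.1 ((Real.exp_pos _).trans_le hn)
  refine ⟨tendsto_prod_lt_hitTime hε1 hsurv, fun h hodd => ?_⟩
  have (n : ℕ) := isProbabilityMeasure_networkFunLaw n (ρ n) (T n) (h n)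
  have hoddT : ∀ᶠ n in atTop, ∀ᵐ f ∂networkFunLaw n (ρ n) (T n) (h n), f.Odd := by
    filter_upwards [hρI, hodd] with n hρn hn using ae_networkFunLaw_odd hρn.2 (T n) hn
  have hstab := tendsto_meanNoiseStab_networkFunLaw hεI hρI hTpos hodd hsurv
  exact ⟨annealedQNS_of_tendsto_meanNoiseStab hε1 hoddT hstab,
    quenchedQNS_of_tendsto_meanNoiseStab hεI hoddT hstab⟩

end Limit

theorem mainTheorem4 :
    ∃ K : ℕ → ℕ,
      ∀ (δ : ℝ) (ε ρ : ℕ → ℝ) (T : ℕ → ℕ),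
        0 < δ →
        (∀ n, ε n ≤ 1 / 2) → Antitone ε → Tendsto ε atTop (𝓝 0) →
        Tendsto (fun n : ℕ => (n : ℝ) * ε n) atTop atTop →
        (∀ᶠ n : ℕ in atTop, δ < ρ n ∧
          ρ n < 1 - 4 * Real.log (Real.log n) ^ 3 / Real.log n) →
        (∀ᶠ n : ℕ in atTop, Real.exp (4 * Real.log (Real.log n) ^ 2) ≤ (T n : ℝ)) →
        Tendsto (fun n => ((networkLaw n).prod (noisyPair n (ε n)))
            {x | (T n : ℕ∞) < hitTime (ρ n) (1 / 2) x.1 x.2.1 x.2.2}) atTop (𝓝 0) ∧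
        ∀ h : (n : ℕ) → BoolFun n, (∀ᶠ n : ℕ in atTop, Function.Odd (h n)) →
          (SharpThresholdAtHalf h →
            AnnealedQNS (fun n => networkFunLaw n (ρ n) (T n) (h n)) ε ∧
            QuenchedQNS (fun n => networkFunLaw n (ρ n) (T n) (h n)) ε) ∧
          ((∀ᶠ n : ℕ in atTop, K n ≤ T n) →
            AnnealedQNS (fun n => networkFunLaw n (ρ n) (T n) (h n)) ε ∧
            QuenchedQNS (fun n => networkFunLaw n (ρ n) (T n) (h n)) ε) := by
  refine ⟨fun _ => 0, fun δ ε ρ T hδ hε _ _ hnε hρ hT => ?_⟩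
  have hgeneral := mainTheorem4_general hδ (.of_forall hε) hnε hρ hT
  exact ⟨hgeneral.1, fun h hodd => ⟨fun _ => hgeneral.2 h hodd, fun _ => hgeneral.2 h hodd⟩⟩

end
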